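/- Let $\Gamma=(m_{i,j})_{i,j\in I}$ be a Coxeter matrix over a finite set $I$, of small type, i.e. $m_{i,j}\in\{1,2,3\}$ for all $i,j$. Let $E=\bigoplus_{i\in I}\mathbb R\alpha_i$ carry the symmetric bilinear form $(\alpha_i|\alpha_j)=-2\cos(\pi/m_{i,j})$ and the action of the Coxeter group $W$ given by $s_i(\beta)=\beta-(\beta|\alpha_i)\alpha_i$. Let $\Phi=\{w(\alpha_i)\mid w\in W,\ i\in I\}$, let $\Phi^+$ be the set of roots with nonnegative coordinates, $\Phi^-=-\Phi^+$, and for $\alpha\in\Phi^+$ let $\mathrm{dep}(\alpha)=\min\{\ell(w)\mid w\in W,\ w(\alpha)\in\Phi^-\}$. The group $\mathrm{Aut}(\Gamma)$ of permutations $g$ of $I$ with $m_{g(i),g(j)}=m_{i,j}$ acts on $E$ by $g(\alpha_i)=\alpha_{g(i)}$, and this action preserves $\Phi^+$. Let $R$ be a commutative ring, $b,c,d\in R^\times$, $a=d-\frac{bc}{d}$, and let $V$ be the free $R$-module with basis $(e_\alpha)_{\alpha\in\Phi^+}$. For $i\in I$ let $\varphi_i$ be the endomorphism of $V$ with $\varphi_i(e_{\alpha_i})=0$,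 $\varphi_i(e_\alpha)=d\,e_\alpha$ if $s_i(\alpha)=\alpha$, and $\varphi_i(e_\beta)=b\,e_\alpha$, $\varphi_i(e_\alpha)=a\,e_\alpha+c\,e_\beta$ if $\alpha,\beta\in\Phi^+$, $\beta=s_i(\alpha)$ and $\mathrm{dep}(\beta)>\mathrm{dep}(\alpha)$. A family $(f_i)_{i\in I}$ of linear forms on $V$ is an *LK-family* if $f_i(e_{\alpha_j})=0$ for $i\ne j$, $f_i\varphi_j=d f_i$ whenever $m_{i,j}=2$, and $f_i\varphi_j=f_j\varphi_i$ whenever $m_{i,j}=3$. Write $f_{i,\alpha}=f_i(e_\alpha)$. *Paris's family.* Fix $x\in R$ and, for each $\alpha\in\Phi^+$ with $\mathrm{dep}(\alpha)\ge2$, an index $j_\alpha$ with $(\alpha|\alpha_{j_\alpha})>0$. Paris's family is defined by induction on $\mathrm{dep}(\alpha)$ by: $f_{i,\alpha_i}=x$; $f_{i,\alpha_j}=0$ for $j\neq i$; $f_{i,\alpha}=-\frac{ax}{c}\left(\frac bd\right)^{\mathrm{dep}(\alpha)-2}$ if $\mathrm{dep}(\alpha)\ge2$ and $(\alpha|\alpha_i)>0$;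 and, if $\mathrm{dep}(\alpha)\ge2$ and $(\alpha|\alpha_i)\le0$, with $j=j_\alpha$ and $\beta=s_j(\alpha)$, - $f_{i,\alpha}=\frac bd f_{i,\beta}$ if $m_{i,j}=2$; - $f_{i,\alpha}=\frac1c\left(b f_{j,\gamma}-a f_{i,\beta}\right)$ if $m_{i,j}=3$ and $\gamma=s_i(\beta)$ satisfies $\mathrm{dep}(\gamma)<\mathrm{dep}(\beta)$; - $f_{i,\alpha}=\frac1c\left(d f_{j,\beta}-a f_{i,\beta}\right)$ if $m_{i,j}=3$ and $s_i(\beta)=\beta$; - $f_{i,\alpha}=\frac bd f_{i,\beta}+\frac dc f_{j,\beta}+\frac{adx}{c^2}\left(\frac bd\right)^{\mathrm{dep}(\alpha)-3}$ if $m_{i,j}=3$ and $\mathrm{dep}(s_i(\beta))>\mathrm{dep}(\beta)$. **Proposition.** Let $(f_i)_{i\in I}$ be an LK-family, and assume that one of the following holds: 1. $\Gamma$ is irreducible (its Coxeter graph is connected) and spherical ($W$ is finite), i.e. $\Gamma$ is of type $A_n$, $D_n$ or $E_n$; 2. $\Gamma$ is affine, i.e. of type $\tilde A_n$ ($n\ge2$),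 $\tilde D_n$ ($n\ge4$) or $\tilde E_n$ ($n=6,7,8$); 3. $(f_i)_{i\in I}$ is Paris's family for some $x\in R$ and some choice of the $j_\alpha$, and Paris's family with this initial value $x$ does not depend on the choice of the $j_\alpha$. Then $f_{i,\alpha}=f_{g(i),g(\alpha)}$ for all $(i,\alpha,g)\in I\times\Phi^+\times\mathrm{Aut}(\Gamma)$. Moreover, if $\Gamma$ has no triangle (no $i,j,k\in I$ with $m_{i,j}=m_{j,k}=m_{k,i}=3$), then for every $x\in R$ Paris's family with initial value $x$ does not depend on the choice of the $j_\alpha$. -/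

import Mathlib

/-! Lawrence-Krammer families attached to a Coxeter matrix: Coxeter graph, standard root system,
depth, graph automorphisms, Lawrence-Krammer families and Paris's recursive family. -/

namespace LK

noncomputable section

/-- The Gram matrix `(α_i | α_j) = -2 cos (π / m_{i,j})`.  In `CoxeterMatrix` the entry `0` stands
for `∞`, and the formula then gives `-2 cos 0 = -2`, as it should. -/
def gram {I : Type*} (M : CoxeterMatrix I) : Matrix I I ℝ :=
  Matrix.of fun i j => -2 * Real.cos (Real.pi / (M i j : ℝ))

/-- The symmetric bilinear form `( . | . )` on `E = ⨁ ℝ α_i`, realised as `I → ℝ`. -/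
def form {I : Type*} [Fintype I] [DecidableEq I] (M : CoxeterMatrix I) :
    LinearMap.BilinForm ℝ (I → ℝ) :=
  Matrix.toBilin' (gram M)

/-- The basis vector `α_i` of `E`. -/
def simple {I : Type*} [DecidableEq I] (i : I) : I → ℝ := Pi.single i 1

theorem gram_symm {I : Type*} (M : CoxeterMatrix I) (i j : I) : gram M i j = gram M j i := by
  simp [gram, M.symmetric i j]

theorem form_simple {I : Type*} [Fintype I] [DecidableEq I] (M : CoxeterMatrix I) (i j : I) :
    form M (simple i) (simple j) = gram M i j := by
  simp [form, simple]

theorem form_self {I : Type*} [Fintype I] [DecidableEq I] (M : CoxeterMatrix I) (i : I) :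
    LinearMap.flip (form M) (simple i) (simple i) = 2 := by
  rw [LinearMap.flip_apply, form_simple]
  simp [gram]

/-- The reflection `s_i(β) = β - (β | α_i) α_i` of `E`. -/
def refl {I : Type*} [Fintype I] [DecidableEq I] (M : CoxeterMatrix I) (i : I) :
    (I → ℝ) ≃ₗ[ℝ] (I → ℝ) :=
  Module.reflection (form_self M i)

theorem refl_apply {I : Type*} [Fintype I] [DecidableEq I] (M : CoxeterMatrix I) (i : I)
    (v : I → ℝ) : refl M i v = v - form M v (simple i) • simple i := by
  simp [refl, Module.reflection_apply]

open Polynomial.Chebyshev in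
/-- Vanishing of the coefficients in the formula for the `m`-th power of a product of two
reflections with angle `π / m`. -/
theorem chebyshev_aux (m : ℕ) (hm : 3 ≤ m) :
    let t : ℝ := 2 * Real.cos (2 * (Real.pi / m))
    (((S ℝ (((m : ℤ) - 2) / 2)).eval t *
        ((S ℝ (((m : ℤ) - 1) / 2)).eval t + (S ℝ (((m : ℤ) - 3) / 2)).eval t)) = 0) ∧
    (((S ℝ (((m : ℤ) - 1) / 2)).eval t *
        ((S ℝ ((m : ℤ) / 2)).eval t + (S ℝ (((m : ℤ) - 2) / 2)).eval t)) = 0) := by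
  intro t
  have hm0 : (0 : ℝ) < m := by positivity
  have hm3 : (3 : ℝ) ≤ m := by exact_mod_cast hm
  have hs : Real.sin (2 * (Real.pi / m)) ≠ 0 := by
    apply ne_of_gt
    apply Real.sin_pos_of_pos_of_lt_pi
    · positivity
    · rw [← mul_div_assoc, div_lt_iff₀ hm0]
      nlinarith [Real.pi_pos]
  have key : ∀ k : ℤ, (S ℝ k).eval t * Real.sin (2 * (Real.pi / m)) =
      Real.sin ((k + 1) * (2 * (Real.pi / m))) := fun k => S_two_mul_real_cos _ k
  rcases Nat.even_or_odd' m with ⟨k, rfl | rfl⟩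
  · have e1 : (((2 * k : ℕ) : ℤ) - 2) / 2 = (k : ℤ) - 1 := by omega
    have e2 : (((2 * k : ℕ) : ℤ) - 1) / 2 = (k : ℤ) - 1 := by omega
    have hz : (S ℝ ((k : ℤ) - 1)).eval t = 0 := by
      apply (mul_eq_zero.mp _).resolve_right hs
      rw [key]
      have hk : (k : ℝ) ≠ 0 := by
        intro h
        push_cast at hm0
        simp [h] at hm0
      have : ((((k : ℤ) - 1 : ℤ) : ℝ) + 1) * (2 * (Real.pi / ((2 * k : ℕ) : ℝ))) = Real.pi := by
        push_cast
        field_simp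
        ring
      rw [this, Real.sin_pi]
    rw [e1, e2, hz]
    simp
  · have e1 : (((2 * k + 1 : ℕ) : ℤ) - 1) / 2 = (k : ℤ) := by omega
    have e2 : (((2 * k + 1 : ℕ) : ℤ) - 3) / 2 = (k : ℤ) - 1 := by omega
    have e3 : (((2 * k + 1 : ℕ) : ℤ)) / 2 = (k : ℤ) := by omega
    have e4 : (((2 * k + 1 : ℕ) : ℤ) - 2) / 2 = (k : ℤ) - 1 := by omega
    have hz : (S ℝ (k : ℤ)).eval t + (S ℝ ((k : ℤ) - 1)).eval t = 0 := by
      apply (mul_eq_zero.mp _).resolve_right hs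
      rw [add_mul, key, key]
      have hk : ((2 * k + 1 : ℕ) : ℝ) ≠ 0 := hm0.ne'
      have : ((((k : ℤ) - 1 : ℤ) : ℝ) + 1) * (2 * (Real.pi / ((2 * k + 1 : ℕ) : ℝ))) =
          2 * Real.pi - (((k : ℤ) : ℝ) + 1) * (2 * (Real.pi / ((2 * k + 1 : ℕ) : ℝ))) := by
        push_cast at hk ⊢
        field_simp
        ring
      rw [this, Real.sin_two_pi_sub]
      ring
    rw [e1, e2, e3, e4, hz]
    simp

/-- The reflections `s_i` satisfy the Coxeter relations. -/
theorem refl_isLiftable {I : Type*} [Fintype I] [DecidableEq I] (M : CoxeterMatrix I) :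
    M.IsLiftable (refl M) := by
  intro i j
  by_cases hij : i = j
  · subst hij
    rw [M.diagonal, pow_one]
    ext1 v
    exact Module.involutive_reflection (form_self M i) v
  · have h1 : M i j ≠ 1 := M.off_diagonal i j hij
    have hsym : gram M j i = gram M i j := gram_symm M j i
    ext1 v
    rw [refl, refl, Module.reflection_mul_reflection_pow_apply]
    simp only [LinearMap.flip_apply, form_simple, hsym]
    rcases Nat.lt_or_ge (M i j) 3 with h | h
    · obtain h0 | h2 : M i j = 0 ∨ M i j = 2 := by omega
      · simp [h0]
      · have hg : gram M i j = 0 := by simp [gram, h2]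
        simp [h2, hg]
        module
    · have ht : gram M i j * gram M i j - 2 = 2 * Real.cos (2 * (Real.pi / (M i j : ℝ))) := by
        rw [Real.cos_two_mul]
        simp only [gram, Matrix.of_apply]
        ring
      obtain ⟨ha, hb⟩ := chebyshev_aux (M i j) h
      rw [ht, ha, hb]
      simp

/-- The action of the Coxeter group `W` on `E`, with `s_i` acting by `refl M i`. -/
def act {I : Type*} [Fintype I] [DecidableEq I] (M : CoxeterMatrix I) :
    M.Group →* ((I → ℝ) ≃ₗ[ℝ] (I → ℝ)) :=
  M.toCoxeterSystem.lift ⟨refl M, refl_isLiftable M⟩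

theorem act_simple {I : Type*} [Fintype I] [DecidableEq I] (M : CoxeterMatrix I) (i : I) :
    act M (M.toCoxeterSystem.simple i) = refl M i :=
  M.toCoxeterSystem.lift_apply_simple (refl_isLiftable M) i

/-- The root system `Φ = {w(α_i)}`. -/
def roots {I : Type*} [Fintype I] [DecidableEq I] (M : CoxeterMatrix I) : Set (I → ℝ) :=
  {v | ∃ (w : M.Group) (i : I), v = act M w (simple i)}

/-- The set `Φ⁺` of positive roots: roots with nonnegative coordinates. -/
def posRoots {I : Type*} [Fintype I] [DecidableEq I] (M : CoxeterMatrix I) : Set (I → ℝ) :=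
  {v | v ∈ roots M ∧ ∀ i, 0 ≤ v i}

/-- The set `Φ⁻ = -Φ⁺` of negative roots. -/
def negRoots {I : Type*} [Fintype I] [DecidableEq I] (M : CoxeterMatrix I) : Set (I → ℝ) :=
  {v | -v ∈ posRoots M}

/-- The depth `min {ℓ(w) | w(α) ∈ Φ⁻}` of a positive root. -/
def depth {I : Type*} [Fintype I] [DecidableEq I] (M : CoxeterMatrix I) (α : I → ℝ) : ℕ :=
  sInf {n | ∃ w : M.Group, M.toCoxeterSystem.length w = n ∧ act M w α ∈ negRoots M}

theorem simple_mem {I : Type*} [Fintype I] [DecidableEq I] (M : CoxeterMatrix I) (i : I) :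
    simple i ∈ posRoots M := by
  refine ⟨⟨1, i, by simp⟩, fun j => ?_⟩
  by_cases h : j = i
  · subst h; simp [simple]
  · simp [simple, h]

/-- The simple root `α_i` as an element of `Φ⁺`. -/
def simpleRoot {I : Type*} [Fintype I] [DecidableEq I] (M : CoxeterMatrix I) (i : I) :
    posRoots M :=
  ⟨simple i, simple_mem M i⟩

/-! ### The Coxeter graph -/

/-- The Coxeter graph: `i` and `j` are joined when `m_{i,j} ≥ 3` or `m_{i,j} = ∞`. -/
def graph {I : Type*} (M : CoxeterMatrix I) : SimpleGraph I where
  Adj i j := i ≠ j ∧ M i j ≠ 2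
  symm := ⟨fun i j h => ⟨h.1.symm, by rw [M.symmetric j i]; exact h.2⟩⟩
  loopless := ⟨fun _ h => h.1 rfl⟩

/-- Small type: all entries belong to `{1, 2, 3}`. -/
def IsSmall {I : Type*} (M : CoxeterMatrix I) : Prop :=
  ∀ i j, M i j = 1 ∨ M i j = 2 ∨ M i j = 3

/-- Irreducible: the Coxeter graph is connected. -/
def IsIrreducible {I : Type*} (M : CoxeterMatrix I) : Prop := (graph M).Connected

/-- Spherical: the Coxeter group is finite. -/
def IsSpherical {I : Type*} (M : CoxeterMatrix I) : Prop := Finite M.Group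

/-- No triangle: there are no `i, j, k` with `m_{i,j} = m_{j,k} = m_{k,i} = 3`. -/
def NoTriangle {I : Type*} (M : CoxeterMatrix I) : Prop :=
  ¬ ∃ i j k, M i j = 3 ∧ M j k = 3 ∧ M k i = 3

/-- The extended Dynkin graph `D̃_n` (`n ≥ 4`) on `{0, …, n}`: the chain `1 - 2 - ⋯ - (n-1)`, with
`0` attached to `2` and `n` attached to `n-2`. -/
def affineD (n : ℕ) : SimpleGraph (Fin (n + 1)) :=
  SimpleGraph.fromRel fun i j =>
    ((i : ℕ) = 0 ∧ (j : ℕ) = 2) ∨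
    (1 ≤ (i : ℕ) ∧ (i : ℕ) + 1 = j ∧ (j : ℕ) + 1 ≤ n) ∨
    ((i : ℕ) + 2 = n ∧ (j : ℕ) = n)

/-- The extended Dynkin graph `Ẽ₆`. -/
def affineE6 : SimpleGraph (Fin 7) :=
  SimpleGraph.fromEdgeSet {s(1, 3), s(3, 4), s(4, 5), s(5, 6), s(2, 4), s(0, 2)}

/-- The extended Dynkin graph `Ẽ₇`. -/
def affineE7 : SimpleGraph (Fin 8) :=
  SimpleGraph.fromEdgeSet {s(1, 3), s(3, 4), s(4, 5), s(5, 6), s(6, 7), s(2, 4), s(0, 1)}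

/-- The extended Dynkin graph `Ẽ₈`. -/
def affineE8 : SimpleGraph (Fin 9) :=
  SimpleGraph.fromEdgeSet
    {s(1, 3), s(3, 4), s(4, 5), s(5, 6), s(6, 7), s(7, 8), s(2, 4), s(0, 8)}

/-- Type `Ã_n` (`n ≥ 2`), `D̃_n` (`n ≥ 4`) or `Ẽ_n` (`n = 6, 7, 8`); a Coxeter matrix of small
type is determined by its Coxeter graph. -/
def IsAffine {I : Type*} (M : CoxeterMatrix I) : Prop :=
  IsSmall M ∧
    ((∃ n, 2 ≤ n ∧ Nonempty (graph M ≃g SimpleGraph.cycleGraph (n + 1))) ∨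
     (∃ n, 4 ≤ n ∧ Nonempty (graph M ≃g affineD n)) ∨
     Nonempty (graph M ≃g affineE6) ∨
     Nonempty (graph M ≃g affineE7) ∨
     Nonempty (graph M ≃g affineE8))

/-! ### Graph automorphisms -/

/-- The group `Aut(Γ)` of permutations `g` of `I` with `m_{g(i),g(j)} = m_{i,j}`. -/
def aut {I : Type*} (M : CoxeterMatrix I) : Subgroup (Equiv.Perm I) where
  carrier := {g | ∀ i j, M (g i) (g j) = M i j}
  mul_mem' := fun {g h} hg hh i j => by
    simp only [Equiv.Perm.mul_apply]
    rw [hg, hh]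
  one_mem' := fun _ _ => rfl
  inv_mem' := fun {g} hg i j => by
    have := hg (g⁻¹ i) (g⁻¹ j)
    simpa using this.symm

/-- The linear action of a permutation of `I` on `E`, with `α_i ↦ α_{g(i)}`. -/
def permE {I : Type*} (g : Equiv.Perm I) : (I → ℝ) ≃ₗ[ℝ] (I → ℝ) :=
  LinearEquiv.funCongrLeft ℝ ℝ g.symm

theorem permE_apply {I : Type*} (g : Equiv.Perm I) (v : I → ℝ) (i : I) :
    permE g v i = v (g.symm i) := rfl

theorem permE_simple {I : Type*} [DecidableEq I] (g : Equiv.Perm I) (i : I) :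
    permE g (simple i) = simple (g i) := by
  ext k
  simp [permE_apply, simple, Pi.single_apply, Equiv.symm_apply_eq]

theorem form_permE {I : Type*} [Fintype I] [DecidableEq I] (M : CoxeterMatrix I)
    (g : aut M) (v w : I → ℝ) :
    form M (permE (g : Equiv.Perm I) v) (permE (g : Equiv.Perm I) w) = form M v w := by
  simp only [form, Matrix.toBilin'_apply, permE_apply]
  rw [← Equiv.sum_comp (g : Equiv.Perm I)]
  refine Finset.sum_congr rfl fun i _ => ?_
  rw [← Equiv.sum_comp (g : Equiv.Perm I)]
  refine Finset.sum_congr rfl fun j _ => ?_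
  have h : M ((g : Equiv.Perm I) i) ((g : Equiv.Perm I) j) = M i j := g.2 i j
  simp [gram, h]

theorem permE_refl {I : Type*} [Fintype I] [DecidableEq I] (M : CoxeterMatrix I)
    (g : aut M) (i : I) (v : I → ℝ) :
    permE (g : Equiv.Perm I) (refl M i v) =
      refl M ((g : Equiv.Perm I) i) (permE (g : Equiv.Perm I) v) := by
  rw [refl_apply, refl_apply, ← permE_simple, form_permE, map_sub, map_smul]

theorem permE_mem {I : Type*} [Fintype I] [DecidableEq I] (M : CoxeterMatrix I)
    (g : aut M) {v : I → ℝ} (hv : v ∈ posRoots M) :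
    permE (g : Equiv.Perm I) v ∈ posRoots M := by
  obtain ⟨⟨w, i, rfl⟩, hpos⟩ := hv
  refine ⟨?_, fun k => hpos _⟩
  clear hpos
  have key : ∀ w : M.Group, ∃ w' : M.Group,
      permE (g : Equiv.Perm I) (act M w (simple i)) = act M w' (simple ((g : Equiv.Perm I) i)) := by
    intro w
    induction w using M.toCoxeterSystem.simple_induction_left with
    | one => exact ⟨1, by simp [permE_simple]⟩
    | mul_simple_left w k ih =>
      obtain ⟨w', hw'⟩ := ih
      refine ⟨M.toCoxeterSystem.simple ((g : Equiv.Perm I) k) * w', ?_⟩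
      rw [map_mul, map_mul, act_simple, act_simple, LinearEquiv.mul_apply, LinearEquiv.mul_apply,
        permE_refl, hw']
  obtain ⟨w', hw'⟩ := key w
  exact ⟨w', _, hw'⟩

/-- The action of `Aut(Γ)` on `Φ⁺`. -/
def autRoot {I : Type*} [Fintype I] [DecidableEq I] (M : CoxeterMatrix I) (g : aut M)
    (α : posRoots M) : posRoots M :=
  ⟨permE (g : Equiv.Perm I) α, permE_mem M g α.2⟩

/-! ### Lawrence-Krammer families -/

/-- The free `R`-module `V` with basis `(e_α)` indexed by `Φ⁺`. -/
abbrev V {I : Type*} [Fintype I] [DecidableEq I] (M : CoxeterMatrix I) (R : Type*) [CommRing R] :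
    Type _ :=
  posRoots M →₀ R

/-- The basis vector `e_α` of `V`. -/
def e {I : Type*} [Fintype I] [DecidableEq I] (M : CoxeterMatrix I) (R : Type*) [CommRing R]
    (α : posRoots M) : V M R :=
  Finsupp.single α 1

open scoped Classical in
/-- `e_v` for a vector `v` of `E` known to be a positive root (and `0` for other vectors; this
value is never used). -/
def eVec {I : Type*} [Fintype I] [DecidableEq I] (M : CoxeterMatrix I) (R : Type*) [CommRing R]
    (v : I → ℝ) : V M R :=
  if h : v ∈ posRoots M then e M R ⟨v, h⟩ else 0

/-- The parameter `a = d - bc/d`. -/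
def aParam {R : Type*} [CommRing R] (b c d : Rˣ) : R := (d : R) - ((b * c / d : Rˣ) : R)

open scoped Classical in
/-- The endomorphism `φ_i` of `V`.  If `α ≠ α_i` then `s_i(α) ∈ Φ⁺`, and either `s_i` fixes `α`, or
`α` is the lower vertex (smaller depth) of the edge `{α, s_i(α)}`, or it is the upper one. -/
def phi {I : Type*} [Fintype I] [DecidableEq I] (M : CoxeterMatrix I) {R : Type*} [CommRing R]
    (b c d : Rˣ) (i : I) : V M R →ₗ[R] V M R :=
  Finsupp.linearCombination R fun α : posRoots M =>
    if (α : I → ℝ) = simple i then 0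
    else if refl M i α = α then (d : R) • e M R α
    else if depth M α < depth M (refl M i α) then
      aParam b c d • e M R α + (c : R) • eVec M R (refl M i α)
    else (b : R) • eVec M R (refl M i α)

/-- `(f_i)` is an LK-family relatively to `(b, c, d)`. -/
structure IsLKFamily {I : Type*} [Fintype I] [DecidableEq I] (M : CoxeterMatrix I) {R : Type*}
    [CommRing R] (b c d : Rˣ) (f : I → Module.Dual R (V M R)) : Prop where
  apply_simple : ∀ i j, i ≠ j → f i (e M R (simpleRoot M j)) = 0
  comp_of_two : ∀ i j, M i j = 2 → f i ∘ₗ phi M b c d j = (d : R) • f i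
  comp_of_three : ∀ i j, M i j = 3 → f i ∘ₗ phi M b c d j = f j ∘ₗ phi M b c d i

/-- An admissible choice of the `j_α`: `(α | α_{j_α}) > 0` for every positive root `α` of depth at
least `2`.  (The values of `j` at other vectors play no role.) -/
def IsChoice {I : Type*} [Fintype I] [DecidableEq I] (M : CoxeterMatrix I) (j : (I → ℝ) → I) :
    Prop :=
  ∀ α ∈ posRoots M, 2 ≤ depth M α → 0 < form M α (simple (j α))

open scoped Classical in
/-- The recursion for the coefficients `f_{i,α}` of Paris's family with initial value `x`, for
positive roots `α` whose depth is at most the first argument.  A positive root has depth at least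
`2` exactly when it is not simple; then, with `β = s_{j_α}(α)` of depth `depth α - 1`, one
distinguishes `m_{i,j_α} = 2` from `m_{i,j_α} = 3`, and in the second case whether `s_i` lowers
the depth of `β`, fixes `β`, or raises the depth of `β`. -/
def parisAux {I : Type*} [Fintype I] [DecidableEq I] (M : CoxeterMatrix I) {R : Type*}
    [CommRing R] (b c d : Rˣ) (x : R) (j : (I → ℝ) → I) : ℕ → I → (I → ℝ) → R
  | 0, _, _ => 0
  | n + 1, i, α =>
    if α = simple i then x
    else if ∃ k, α = simple k then 0
    else if 0 < form M α (simple i) then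
      -(aParam b c d * x * ((c⁻¹ : Rˣ) : R)) * (((b / d) ^ ((depth M α : ℤ) - 2) : Rˣ) : R)
    else if M i (j α) = 2 then
      ((b / d : Rˣ) : R) * parisAux M b c d x j n i (refl M (j α) α)
    else if depth M (refl M i (refl M (j α) α)) < depth M (refl M (j α) α) then
      ((c⁻¹ : Rˣ) : R) * ((b : R) * parisAux M b c d x j n (j α) (refl M i (refl M (j α) α))
        - aParam b c d * parisAux M b c d x j n i (refl M (j α) α))
    else if refl M i (refl M (j α) α) = refl M (j α) α then
      ((c⁻¹ : Rˣ) : R) * ((d : R) * parisAux M b c d x j n (j α) (refl M (j α) α)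
        - aParam b c d * parisAux M b c d x j n i (refl M (j α) α))
    else
      ((b / d : Rˣ) : R) * parisAux M b c d x j n i (refl M (j α) α)
        + ((d / c : Rˣ) : R) * parisAux M b c d x j n (j α) (refl M (j α) α)
        + aParam b c d * (d : R) * x * (((c ^ 2)⁻¹ : Rˣ) : R)
          * (((b / d) ^ ((depth M α : ℤ) - 3) : Rˣ) : R)

/-- Paris's family `(f_i)` for the initial value `x` and the choice `j` of the `j_α`. -/
def parisFamily {I : Type*} [Fintype I] [DecidableEq I] (M : CoxeterMatrix I) {R : Type*}
    [CommRing R] (b c d : Rˣ) (x : R) (j : (I → ℝ) → I) (i : I) : Module.Dual R (V M R) :=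
  Finsupp.linearCombination R fun α : posRoots M => parisAux M b c d x j (depth M α) i α

/-- Paris's family with initial value `x` does not depend on the choice of the `j_α`. -/
def ParisIndep {I : Type*} [Fintype I] [DecidableEq I] (M : CoxeterMatrix I) {R : Type*}
    [CommRing R] (b c d : Rˣ) (x : R) : Prop :=
  ∀ j j', IsChoice M j → IsChoice M j' → parisFamily M b c d x j = parisFamily M b c d x j'

end

end LK

namespace LK

set_option linter.unusedSectionVars false

/-! ### The bilinear form and the simple reflections in small type. -/

variable {I : Type*} [Fintype I] [DecidableEq I]

/-! Write `A i v` for the coefficient f_{i,v}. In small type the pairings (v|α_i) of a root with the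
simple roots are integers, and s_i lowers, fixes or raises the depth of a positive root v ≠ α_i
according to the sign of (v|α_i). With depth thus read off from signs, the conditions on an
LK-family become linear equations between coefficients at neighbouring roots.

Spherical and affine cases. The transport of an LK-family by an automorphism g is again an
LK-family, and so is the difference of the two. By `LKEq.eq_zero_of_lower` the equations determine
`A i v` from lower depth as soon as -2 < (v|α_i) < 2, so by induction on the depth the difference
vanishes at all such pairs. Only the exceptional pairs remain. If W is finite, averaging an inner
product over W leaves only v = α_i as exceptional, and the values f_{i,α_i} agree along edges of the
connected graph. If Γ is affine, the form is positive semidefinite with radical ℝδ, so the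
exceptional roots are kδ + α_i and kδ - α_i. The first kind is constant along edges, as before. For
the second kind, the discrepancy between the family and its transport is, by induction, the same at
every vertex; it is zero for an automorphism fixing a vertex or flipping an edge. A general g is
handled by finding such a ρ that brings g(o) back to a well chosen vertex o.

Paris's family. The substitution G_{i,v} = (b/d)^(2 - dep v) f_{i,v} + ax/c turns the recursion into
one without inhomogeneous terms or depth factors, depending only on q = d²/(bc); G vanishes at the
non-simple v with (v|α_i) > 0. Transport by g replaces the choice j by its conjugate, so
independence of the choice yields invariance. Without triangles, independence is a confluence
statement (`LocalRules.confluence`): two descents j, k of v give the same value, as is checked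
inside the rank 3 subsystem {i, j, k} with the recursion known in lower depth
(`ParisSystem.rule_of_pos`). -/

theorem form_comm (M : CoxeterMatrix I) (v w : I → ℝ) : form M v w = form M w v := by
  simp only [form, Matrix.toBilin'_apply]
  rw [Finset.sum_comm]
  refine Finset.sum_congr rfl fun i _ => Finset.sum_congr rfl fun j _ => ?_
  rw [gram_symm]
  ring

theorem gram_self (M : CoxeterMatrix I) (i : I) : gram M i i = 2 := by
  simp [gram]

theorem gram_of_two {M : CoxeterMatrix I} {i j : I} (h : M i j = 2) : gram M i j = 0 := by
  simp [gram, h]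

theorem gram_of_three {M : CoxeterMatrix I} {i j : I} (h : M i j = 3) : gram M i j = -1 := by
  simp [gram, h]

theorem ne_of_two {M : CoxeterMatrix I} {i j : I} (h : M i j = 2) : i ≠ j := by
  rintro rfl
  simp at h

theorem ne_of_three {M : CoxeterMatrix I} {i j : I} (h : M i j = 3) : i ≠ j := by
  rintro rfl
  simp at h

theorem IsSmall.cases {M : CoxeterMatrix I} (hM : IsSmall M) (i j : I) :
    i = j ∨ M i j = 2 ∨ M i j = 3 := by
  by_cases h : i = j
  · exact Or.inl h
  · have := M.off_diagonal i j h
    have := hM i j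
    tauto

theorem IsSmall.gram_cases {M : CoxeterMatrix I} (hM : IsSmall M) (i j : I) :
    i = j ∧ gram M i j = 2 ∨ i ≠ j ∧ M i j = 2 ∧ gram M i j = 0 ∨
      i ≠ j ∧ M i j = 3 ∧ gram M i j = -1 := by
  rcases hM.cases i j with rfl | h | h
  · exact Or.inl ⟨rfl, gram_self M i⟩
  · exact Or.inr (Or.inl ⟨ne_of_two h, h, gram_of_two h⟩)
  · exact Or.inr (Or.inr ⟨ne_of_three h, h, gram_of_three h⟩)

theorem form_refl (M : CoxeterMatrix I) (i k : I) (v : I → ℝ) :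
    form M (refl M i v) (simple k) =
      form M v (simple k) - form M v (simple i) * gram M i k := by
  simp [refl_apply, form_simple]

theorem form_refl_self (M : CoxeterMatrix I) (i : I) (v : I → ℝ) :
    form M (refl M i v) (simple i) = -form M v (simple i) := by
  rw [form_refl, gram_self]
  ring

theorem form_refl_refl (M : CoxeterMatrix I) (i : I) (v w : I → ℝ) :
    form M (refl M i v) (refl M i w) = form M v w := by
  simp only [refl_apply, map_sub, map_smul, LinearMap.sub_apply, LinearMap.smul_apply,
    smul_eq_mul, form_simple, gram_self, form_comm M (simple i) w]
  ring

theorem refl_refl (M : CoxeterMatrix I) (i : I) (v : I → ℝ) : refl M i (refl M i v) = v := by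
  rw [refl_apply, form_refl_self, refl_apply]
  module

theorem refl_eq_self {M : CoxeterMatrix I} {i : I} {v : I → ℝ} (h : form M v (simple i) = 0) :
    refl M i v = v := by
  simp [refl_apply, h]

theorem refl_simple_self (M : CoxeterMatrix I) (i : I) : refl M i (simple i) = -simple i := by
  rw [refl_apply, form_simple, gram_self]
  module

theorem refl_simple_of_three {M : CoxeterMatrix I} {i j : I} (h : M i j = 3) :
    refl M j (simple i) = simple i + simple j := by
  rw [refl_apply, form_simple, gram_of_three h]
  module

theorem refl_apply_of_ne (M : CoxeterMatrix I) {i k : I} (h : k ≠ i) (v : I → ℝ) :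
    refl M i v k = v k := by
  simp [refl_apply, simple, h]

theorem refl_apply_self (M : CoxeterMatrix I) (i : I) (v : I → ℝ) :
    refl M i v i = v i - form M v (simple i) := by
  simp [refl_apply, simple]

theorem refl_comm {M : CoxeterMatrix I} {i j : I} (h : M i j = 2) (v : I → ℝ) :
    refl M i (refl M j v) = refl M j (refl M i v) := by
  have h' : gram M j i = 0 := by rw [gram_symm, gram_of_two h]
  rw [refl_apply M i, refl_apply M j (refl M i v), form_refl, form_refl, h', gram_of_two h,
    refl_apply, refl_apply]
  module

theorem refl_braid {M : CoxeterMatrix I} {i j : I} (h : M i j = 3) (v : I → ℝ) :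
    refl M i (refl M j (refl M i v)) = refl M j (refl M i (refl M j v)) := by
  have h' : gram M j i = -1 := by rw [gram_symm, gram_of_three h]
  rw [refl_apply M i (refl M j (refl M i v)), refl_apply M j (refl M i (refl M j v)),
    refl_apply M j (refl M i v), refl_apply M i (refl M j v)]
  simp only [map_sub, map_smul, LinearMap.sub_apply, LinearMap.smul_apply,
    smul_eq_mul, form_simple, h', gram_of_three h, gram_self, refl_apply]
  module

theorem simple_injective : Function.Injective (simple : I → I → ℝ) := by
  intro i j h
  by_contra hne
  have := congrFun h i
  simp [simple, hne] at this

/-! ### Positive roots, levels and depth. -/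

/-- Vectors obtained from a simple root by `n - 1` successive simple reflections, each of which
increases a coordinate. -/
inductive Lev (M : CoxeterMatrix I) : ℕ → (I → ℝ) → Prop
  | simple (i : I) : Lev M 1 (simple i)
  | raise {n : ℕ} {v : I → ℝ} (i : I) : Lev M n v → form M v (LK.simple i) < 0 →
      Lev M (n + 1) (refl M i v)

variable {M : CoxeterMatrix I}

theorem Lev.nonneg {n : ℕ} {v : I → ℝ} (h : Lev M n v) (k : I) : 0 ≤ v k := by
  induction h with
  | simple i =>
    by_cases hk : k = i
    · subst hk; simp [LK.simple]
    · simp [LK.simple, hk]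
  | raise i _ hneg ih =>
    by_cases hk : k = i
    · subst hk
      rw [refl_apply_self]
      linarith
    · rwa [refl_apply_of_ne M hk]

theorem Lev.pos {n : ℕ} {v : I → ℝ} (h : Lev M n v) : 1 ≤ n := by
  cases h <;> omega

theorem Lev.norm {n : ℕ} {v : I → ℝ} (h : Lev M n v) : form M v v = 2 := by
  induction h with
  | simple i => rw [form_simple, gram_self]
  | raise i _ _ ih => rw [form_refl_refl, ih]

theorem Lev.not_neg {n m : ℕ} {v : I → ℝ} (h : Lev M n v) (h' : Lev M m (-v)) : False := by
  have : v = 0 := by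
    ext k
    have := h.nonneg k
    have := h'.nonneg k
    simp at *
    linarith
  have h2 := h.norm
  simp [this] at h2

theorem Lev.form_int (hM : IsSmall M) {n : ℕ} {v : I → ℝ} (h : Lev M n v) (k : I) :
    ∃ z : ℤ, form M v (LK.simple k) = z := by
  have hg : ∀ i j, ∃ z : ℤ, gram M i j = z := fun i j => by
    rcases hM.gram_cases i j with h | h | h
    · exact ⟨2, by simp [h.2]⟩
    · exact ⟨0, by simp [h.2.2]⟩
    · exact ⟨-1, by simp [h.2.2]⟩
  induction h generalizing k with
  | simple i => rw [form_simple]; exact hg i k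
  | raise i _ _ ih =>
    obtain ⟨x, hx⟩ := ih k
    obtain ⟨y, hy⟩ := ih i
    obtain ⟨z, hz⟩ := hg i k
    exact ⟨x - y * z, by rw [form_refl, hx, hy, hz]; push_cast; rfl⟩

theorem Lev.coord_int (hM : IsSmall M) {n : ℕ} {v : I → ℝ} (h : Lev M n v) (k : I) :
    ∃ z : ℤ, v k = z := by
  induction h with
  | simple i =>
    by_cases hk : k = i
    · exact ⟨1, by simp [LK.simple, hk]⟩
    · exact ⟨0, by simp [LK.simple, hk]⟩
  | raise i hv _ ih =>
    obtain ⟨x, hx⟩ := ih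
    by_cases hk : k = i
    · obtain ⟨y, hy⟩ := hv.form_int hM i
      subst hk
      exact ⟨x - y, by rw [refl_apply_self, hx, hy]; push_cast; rfl⟩
    · exact ⟨x, by rw [refl_apply_of_ne M hk, hx]⟩

theorem IsSmall.eq_of_gram_pos (hM : IsSmall M) {i j : I} (h : 0 < gram M i j) : i = j := by
  rcases hM.gram_cases i j with h' | h' | h'
  · exact h'.1
  · linarith [h'.2.2]
  · linarith [h'.2.2]

theorem Lev.eq_one (hM : IsSmall M) {n : ℕ} {i : I} (h : Lev M n (LK.simple i)) : n = 1 := by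
  generalize hv : LK.simple i = v at h
  cases h with
  | simple => rfl
  | @raise n v j h hneg =>
    have h1 : form M (LK.simple i) (LK.simple j) = -form M v (LK.simple j) := by
      rw [hv, form_refl_self]
    rw [form_simple] at h1
    have hij : i = j := hM.eq_of_gram_pos (by linarith)
    subst hij
    have h2 : v = -LK.simple i := by
      rw [← refl_simple_self M i, hv, refl_refl]
    have := h.nonneg i
    rw [h2] at this
    simp [LK.simple] at this
    linarith

/-- A non-simple positive root `v` has `(v | α_i) > 0` for some `i`. -/
theorem Lev.exists_pos {n : ℕ} {v : I → ℝ} (h : Lev M n v) (hv : ∀ i, v ≠ LK.simple i) :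
    ∃ i, 0 < form M v (LK.simple i) := by
  cases h with
  | simple i => exact absurd rfl (hv i)
  | raise i _ hneg => exact ⟨i, by rw [form_refl_self]; linarith⟩

/-- This makes the level intrinsic: a raising path is given by some last reflection s_j, and the
lemma shows that any other s_i pairing positively with the root could have been the last one. -/
theorem Lev.descent (hM : IsSmall M) {n : ℕ} {v : I → ℝ} {i : I} (h : Lev M n v)
    (hv : v ≠ LK.simple i) (hpos : 0 < form M v (LK.simple i)) :
    ∃ m, n = m + 1 ∧ Lev M m (refl M i v) := by
  induction n using Nat.strong_induction_on generalizing v i with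
  | _ n ih =>
  cases h with
  | simple j =>
    rw [form_simple] at hpos
    exact absurd (congrArg LK.simple (hM.eq_of_gram_pos hpos).symm) hv.symm
  | @raise n u j hu hneg =>
    refine ⟨n, rfl, ?_⟩
    rcases hM.gram_cases j i with ⟨rfl, -⟩ | ⟨hne, h2, hg⟩ | ⟨hne, h3, hg⟩
    · rwa [refl_refl]
    · have hp : 0 < form M u (LK.simple i) := by simpa [form_refl, hg] using hpos
      have hui : u ≠ LK.simple i := by
        rintro rfl
        rw [form_simple, gram_symm, hg] at hneg
        exact lt_irrefl _ hneg
      obtain ⟨m, rfl, hm⟩ := ih n (by omega) hu hui hp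
      rw [← refl_comm h2]
      refine hm.raise j ?_
      rw [form_refl, gram_symm, hg]
      simpa using hneg
    -- Here v = s_j u, and both (u|α_i) and (s_i u|α_j) = (u|α_i) + (u|α_j) are positive. So u
    -- descends through s_i u to s_j s_i u, and raising twice gives s_j s_i s_j s_i s_j s_j-free
    -- words: by the braid relation s_i s_j s_i u = s_j s_i s_j u, whose image by s_j is s_i v. The
    -- case u = α_i, where the descent stops at once, is separate.
    · have hg' : gram M i j = -1 := by rw [gram_symm, hg]
      have h3' : M i j = 3 := by rw [M.symmetric, h3]
      have hp : 0 < form M u (LK.simple i) + form M u (LK.simple j) := by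
        simpa [form_refl, hg] using hpos
      by_cases hui : u = LK.simple i
      · subst hui
        rw [hu.eq_one hM]
        have : refl M i (refl M j (LK.simple i)) = LK.simple j := by
          rw [refl_simple_of_three h3', add_comm, ← refl_simple_of_three h3, refl_refl]
        rw [this]
        exact Lev.simple j
      · obtain ⟨m, rfl, hm⟩ := ih n (by omega) hu hui (by linarith)
        have e1 : form M (refl M i u) (LK.simple j) =
            form M u (LK.simple j) + form M u (LK.simple i) := by
          rw [form_refl, hg']; ring
        have hne' : refl M i u ≠ LK.simple j := by
          intro h
          have : form M u (LK.simple j) = 1 := by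
            rw [← refl_refl M i u, h, form_refl, form_simple, form_simple, gram_self, hg, hg']
            ring
          linarith
        obtain ⟨m, rfl, hm2⟩ := ih m (by omega) hm hne' (by linarith)
        have h4 := hm2.raise i (by
          rw [form_refl, e1, hg, form_refl_self]; linarith)
        rw [refl_braid h3'] at h4
        have h5 := h4.raise j (by
          rw [form_refl_self, form_refl, hg', form_refl_self, form_refl, hg]; linarith)
        rwa [refl_refl] at h5

theorem Lev.refl_cases (hM : IsSmall M) {n : ℕ} {v : I → ℝ} (h : Lev M n v) (i : I) :
    v = LK.simple i ∧ refl M i v = -LK.simple i ∨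
    form M v (LK.simple i) = 0 ∧ refl M i v = v ∨
    form M v (LK.simple i) < 0 ∧ Lev M (n + 1) (refl M i v) ∨
    v ≠ LK.simple i ∧ 0 < form M v (LK.simple i) ∧ ∃ m, n = m + 1 ∧ Lev M m (refl M i v) := by
  by_cases hv : v = LK.simple i
  · exact Or.inl ⟨hv, by rw [hv, refl_simple_self]⟩
  · rcases lt_trichotomy (form M v (LK.simple i)) 0 with h0 | h0 | h0
    · exact Or.inr (Or.inr (Or.inl ⟨h0, h.raise i h0⟩))
    · exact Or.inr (Or.inl ⟨h0, refl_eq_self h0⟩)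
    · exact Or.inr (Or.inr (Or.inr ⟨hv, h0, h.descent hM hv h0⟩))

theorem Lev.refl_of_ne (hM : IsSmall M) {n : ℕ} {v : I → ℝ} (h : Lev M n v) {i : I}
    (hv : v ≠ LK.simple i) : ∃ m, Lev M m (refl M i v) := by
  rcases h.refl_cases hM i with h1 | h1 | h1 | ⟨-, -, m, -, h1⟩
  · exact absurd h1.1 hv
  · exact ⟨n, by rwa [h1.2]⟩
  · exact ⟨_, h1.2⟩
  · exact ⟨m, h1⟩

theorem Lev.mem_roots {n : ℕ} {v : I → ℝ} (h : Lev M n v) : v ∈ roots M := by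
  induction h with
  | simple i => exact ⟨1, i, by simp⟩
  | raise i _ _ ih =>
    obtain ⟨w, k, rfl⟩ := ih
    exact ⟨M.toCoxeterSystem.simple i * w, k, by rw [map_mul, act_simple]; rfl⟩

theorem Lev.mem {n : ℕ} {v : I → ℝ} (h : Lev M n v) : v ∈ posRoots M :=
  ⟨h.mem_roots, h.nonneg⟩

theorem exists_lev_or_neg (hM : IsSmall M) (w : M.Group) (i : I) :
    ∃ n, Lev M n (act M w (simple i)) ∨ Lev M n (-act M w (simple i)) := by
  induction w using M.toCoxeterSystem.simple_induction_left with
  | one => exact ⟨1, Or.inl (by simpa using Lev.simple i)⟩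
  | mul_simple_left w k ih =>
    have aux : ∀ n v, Lev M n v → ∃ n, Lev M n (refl M k v) ∨ Lev M n (-refl M k v) := by
      intro n v h
      by_cases hv : v = simple k
      · exact ⟨1, Or.inr (by rw [hv, refl_simple_self, neg_neg]; exact Lev.simple k)⟩
      · obtain ⟨m, hm⟩ := h.refl_of_ne hM hv
        exact ⟨m, Or.inl hm⟩
    rw [map_mul, act_simple, LinearEquiv.mul_apply]
    obtain ⟨n, h | h⟩ := ih
    · exact aux _ _ h
    · obtain ⟨m, h'⟩ := aux _ _ h
      rw [map_neg, neg_neg] at h'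
      exact ⟨m, h'.symm⟩

theorem exists_lev (hM : IsSmall M) {v : I → ℝ} (h : v ∈ posRoots M) : ∃ n, Lev M n v := by
  obtain ⟨⟨w, i, rfl⟩, hpos⟩ := h
  obtain ⟨n, h | h⟩ := exists_lev_or_neg hM w i
  · exact ⟨n, h⟩
  · exfalso
    have h0 : -act M w (simple i) = 0 := by
      ext k
      have h1 := h.nonneg k
      have h2 := hpos k
      simp only [Pi.neg_apply, Pi.zero_apply] at *
      linarith
    have h2 := h.norm
    rw [h0] at h2
    simp at h2

/-- A simple reflection changes the level by at most one, and the only positive root that s_i makes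
negative is α_i, of level 1. Hence a word must have at least n letters to make a root of level n
negative; `Lev.exists_word` attains this bound. -/
theorem Lev.le_length (hM : IsSmall M) (ω : List I) :
    ∀ {n : ℕ} {v : I → ℝ}, Lev M n v →
      act M (M.toCoxeterSystem.wordProd ω) v ∈ negRoots M → n ≤ ω.length := by
  induction ω using List.reverseRecOn with
  | nil =>
    intro n v h hneg
    obtain ⟨m, hm⟩ := exists_lev hM hneg
    simp only [CoxeterSystem.wordProd_nil, map_one, LinearEquiv.coe_one, id] at hm
    exact (h.not_neg hm).elim
  | append_singleton ω i ih =>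
    intro n v h hneg
    rw [CoxeterSystem.wordProd_append, CoxeterSystem.wordProd_singleton, map_mul, act_simple,
      LinearEquiv.mul_apply] at hneg
    rw [List.length_append, List.length_singleton]
    rcases h.refl_cases hM i with h1 | h1 | h1 | ⟨-, -, m, rfl, h1⟩
    · rw [h1.1] at h
      have := h.eq_one hM
      omega
    · rw [h1.2] at hneg
      have := ih h hneg
      omega
    · have := ih h1.2 hneg
      omega
    · have := ih h1 hneg
      omega

theorem Lev.exists_word {n : ℕ} {v : I → ℝ} (h : Lev M n v) :
    ∃ ω : List I, ω.length = n ∧ act M (M.toCoxeterSystem.wordProd ω) v ∈ negRoots M := by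
  induction h with
  | simple i =>
    refine ⟨[i], rfl, ?_⟩
    rw [CoxeterSystem.wordProd_singleton, act_simple, refl_simple_self]
    simpa [negRoots] using simple_mem M i
  | raise i h hneg ih =>
    obtain ⟨ω, rfl, hω⟩ := ih
    refine ⟨ω ++ [i], by simp, ?_⟩
    rwa [CoxeterSystem.wordProd_append, CoxeterSystem.wordProd_singleton, map_mul, act_simple,
      LinearEquiv.mul_apply, refl_refl]

theorem Lev.depth_eq (hM : IsSmall M) {n : ℕ} {v : I → ℝ} (h : Lev M n v) : depth M v = n := by
  obtain ⟨ω, hω, hneg⟩ := h.exists_word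
  apply le_antisymm
  · have h1 : depth M v ≤ M.toCoxeterSystem.length (M.toCoxeterSystem.wordProd ω) :=
      Nat.sInf_le ⟨_, rfl, hneg⟩
    exact h1.trans (hω ▸ M.toCoxeterSystem.length_wordProd_le ω)
  · obtain ⟨w, hw, hneg'⟩ := Nat.sInf_mem (s := {n | ∃ w : M.Group,
      M.toCoxeterSystem.length w = n ∧ act M w v ∈ negRoots M}) ⟨_, _, rfl, hneg⟩
    obtain ⟨ω', h1, rfl⟩ := M.toCoxeterSystem.exists_isReduced w
    rw [depth, ← hw, h1.eq]
    exact h.le_length hM ω' hneg'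

theorem lev_depth (hM : IsSmall M) {v : I → ℝ} (h : v ∈ posRoots M) : Lev M (depth M v) v := by
  obtain ⟨n, hn⟩ := exists_lev hM h
  rwa [hn.depth_eq hM]

theorem Lev.permE (g : aut M) {n : ℕ} {v : I → ℝ} (h : Lev M n v) :
    Lev M n (LK.permE (g : Equiv.Perm I) v) := by
  induction h with
  | simple i => rw [permE_simple]; exact Lev.simple _
  | raise i h hneg ih =>
    rw [permE_refl]
    refine ih.raise _ ?_
    rwa [← permE_simple, form_permE]

/-! ### The LK equations on coefficients. -/

variable {R : Type*} [CommRing R]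

open scoped Classical in
/-- The value of `f_i φ_j` at `e_v`, in terms of the coefficients `A i v = f_i (e_v)`. -/
noncomputable def compVal (M : CoxeterMatrix I) (a b c d : R) (A : I → (I → ℝ) → R) (i j : I)
    (v : I → ℝ) : R :=
  if v = simple j then 0
  else if form M v (simple j) = 0 then d * A i v
  else if form M v (simple j) < 0 then a * A i v + c * A i (refl M j v)
  else b * A i (refl M j v)

/-- The equations satisfied by the coefficients of an LK-family. -/
structure LKEq (M : CoxeterMatrix I) (a b c d : R) (A : I → (I → ℝ) → R) : Prop where
  apply_simple : ∀ i j, i ≠ j → A i (simple j) = 0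
  comp_of_two : ∀ i j, M i j = 2 → ∀ n v, Lev M n v → compVal M a b c d A i j v = d * A i v
  comp_of_three : ∀ i j, M i j = 3 → ∀ n v, Lev M n v →
    compVal M a b c d A i j v = compVal M a b c d A j i v

/-- Evaluates the operator identities at the basis vectors; `Lev.refl_cases` replaces the comparison
of depths in `phi` by the sign of (v|α_j). -/
theorem IsLKFamily.lkEq (hM : IsSmall M) {b c d : Rˣ} {f : I → Module.Dual R (V M R)}
    (hf : IsLKFamily M b c d f) :
    LKEq M (aParam b c d) (b : R) (c : R) (d : R) fun i v => f i (eVec M R v) := by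
  have key : ∀ i j n v, Lev M n v → f i (phi M b c d j (eVec M R v)) =
      compVal M (aParam b c d) (b : R) (c : R) (d : R) (fun i v => f i (eVec M R v)) i j v := by
    intro i j n v h
    have e1 : eVec M R v = e M R ⟨v, h.mem⟩ := by rw [eVec, dif_pos h.mem]
    have e2 := congrArg (phi M b c d j) e1
    rw [e, phi, Finsupp.linearCombination_single, one_smul, ← phi] at e2
    rw [compVal, e2]
    rcases h.refl_cases hM j with h1 | h1 | h1 | ⟨h0, h2, m, rfl, h3⟩
    · simp [h1.1]
    · have h0 : v ≠ simple j := by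
        rintro rfl
        simp [form_simple, gram_self] at h1
      simp [e1, h1.1, h0, h1.2]
    · have h0 : v ≠ simple j := by
        rintro rfl
        have := h1.1
        rw [form_simple, gram_self] at this
        linarith
      have h2 : refl M j v ≠ v := by
        intro h3
        have := form_refl_self M j v
        rw [h3] at this
        linarith [h1.1]
      have h3 : depth M v < depth M (refl M j v) := by
        rw [h.depth_eq hM, h1.2.depth_eq hM]; omega
      simp [e1, h1.1, h1.1.ne, h0, h2, h3]
    · have h4 : refl M j v ≠ v := by
        intro h3
        have := form_refl_self M j v
        rw [h3] at this
        linarith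
      have h5 : ¬ depth M v < depth M (refl M j v) := by
        rw [h.depth_eq hM, h3.depth_eq hM]; omega
      simp [h2.ne', h0, h2.not_gt, h4, h5]
  refine ⟨fun i j hij => ?_, fun i j hij n v h => ?_, fun i j hij n v h => ?_⟩
  · have := hf.apply_simple i j hij
    rwa [simpleRoot, ← show eVec M R (simple j) = _ from dif_pos (simple_mem M j)] at this
  · rw [← key i j n v h, ← LinearMap.comp_apply, hf.comp_of_two i j hij]
    rfl
  · rw [← key i j n v h, ← key j i n v h, ← LinearMap.comp_apply, hf.comp_of_three i j hij]
    rfl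

section LKEq

variable {a b c d : R} {A B : I → (I → ℝ) → R}

theorem compVal_simple (i j : I) : compVal M a b c d A i j (simple j) = 0 := by
  simp [compVal]

theorem ne_simple_of_nonpos {v : I → ℝ} {j : I} (h : form M v (simple j) ≤ 0) : v ≠ simple j := by
  rintro rfl
  rw [form_simple, gram_self] at h
  linarith

theorem compVal_zero (i : I) {j : I} {v : I → ℝ} (h : form M v (simple j) = 0) :
    compVal M a b c d A i j v = d * A i v := by
  rw [compVal, if_neg (ne_simple_of_nonpos h.le), if_pos h]

theorem compVal_neg (i : I) {j : I} {v : I → ℝ} (h : form M v (simple j) < 0) :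
    compVal M a b c d A i j v = a * A i v + c * A i (refl M j v) := by
  rw [compVal, if_neg (ne_simple_of_nonpos h.le), if_neg h.ne, if_pos h]

theorem compVal_pos (i : I) {j : I} {v : I → ℝ} (h0 : v ≠ simple j)
    (h : 0 < form M v (simple j)) :
    compVal M a b c d A i j v = b * A i (refl M j v) := by
  rw [compVal, if_neg h0, if_neg h.ne', if_neg h.not_gt]

theorem compVal_sub (i j : I) (v : I → ℝ) :
    compVal M a b c d (fun i v => A i v - B i v) i j v =
      compVal M a b c d A i j v - compVal M a b c d B i j v := by
  simp only [compVal]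
  split_ifs <;> ring

theorem compVal_permE (g : aut M) (i j : I) (v : I → ℝ) :
    compVal M a b c d
        (fun i v => A ((g : Equiv.Perm I) i) (permE (g : Equiv.Perm I) v)) i j v =
      compVal M a b c d A ((g : Equiv.Perm I) i) ((g : Equiv.Perm I) j)
        (permE (g : Equiv.Perm I) v) := by
  simp only [compVal, permE_refl, ← permE_simple, form_permE, EmbeddingLike.apply_eq_iff_eq]

theorem LKEq.sub (hA : LKEq M a b c d A) (hB : LKEq M a b c d B) :
    LKEq M a b c d fun i v => A i v - B i v where
  apply_simple i j hij := by rw [hA.apply_simple i j hij, hB.apply_simple i j hij, sub_zero]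
  comp_of_two i j hij n v h := by
    rw [compVal_sub, hA.comp_of_two i j hij n v h, hB.comp_of_two i j hij n v h, mul_sub]
  comp_of_three i j hij n v h := by
    rw [compVal_sub, compVal_sub, hA.comp_of_three i j hij n v h, hB.comp_of_three i j hij n v h]

theorem LKEq.permE (hA : LKEq M a b c d A) (g : aut M) :
    LKEq M a b c d
      fun i v => A ((g : Equiv.Perm I) i) (LK.permE (g : Equiv.Perm I) v) where
  apply_simple i j hij := by
    rw [permE_simple, hA.apply_simple _ _ (g.1.injective.ne hij)]
  comp_of_two i j hij n v h := by
    rw [compVal_permE, hA.comp_of_two _ _ ((g.2 i j).trans hij) n _ (h.permE g)]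
  comp_of_three i j hij n v h := by
    rw [compVal_permE, compVal_permE, hA.comp_of_three _ _ ((g.2 i j).trans hij) n _ (h.permE g)]

/-- If the family vanishes in depth less than `n`, then it vanishes at the roots `v` of depth `n`
with `-2 < (v | α_i) < 2`. -/
theorem LKEq.eq_zero_of_lower (hM : IsSmall M) (hc : IsUnit c) (hd : IsUnit d)
    (hA : LKEq M a b c d A) {n : ℕ}
    (hlow : ∀ m < n, ∀ v, Lev M m v → ∀ i, A i v = 0) {v : I → ℝ} (hv : Lev M n v) {i : I}
    (h1 : -2 < form M v (simple i)) (h2 : form M v (simple i) < 2) : A i v = 0 := by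
  by_cases hs : ∃ j, v = simple j
  · obtain ⟨j, rfl⟩ := hs
    refine hA.apply_simple i j ?_
    rintro rfl
    rw [form_simple, gram_self] at h2
    exact lt_irrefl _ h2
  push Not at hs
  obtain ⟨zi, hzi⟩ := hv.form_int hM i
  -- If some other α_j pairs positively with v, an equation for (i, j) expresses `A i v` through
  -- lower depth: at v when m_{i,j} = 2, at s_j v when m_{i,j} = 3.
  by_cases hj : ∃ j, j ≠ i ∧ 0 < form M v (simple j)
  · obtain ⟨j, hji, hj⟩ := hj
    obtain ⟨m, rfl, hm⟩ := hv.descent hM (hs j) hj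
    have hlow1 := hlow m (by omega) _ hm
    have hback : refl M j (refl M j v) = v := refl_refl M j v
    have hneg : form M (refl M j v) (simple j) < 0 := by rw [form_refl_self]; linarith
    rcases hM.gram_cases i j with h | ⟨-, h, hg⟩ | ⟨-, h, hg⟩
    · exact absurd h.1.symm hji
    · have e := hA.comp_of_two i j h _ v hv
      rw [compVal_pos i (hs j) hj, hlow1, mul_zero] at e
      exact (hd.mul_right_eq_zero).mp e.symm
    · have hg' : gram M j i = -1 := by rw [gram_symm, hg]
      have e := hA.comp_of_three i j h _ _ hm
      rw [compVal_neg i hneg, hback, hlow1, mul_zero, zero_add] at e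
      refine (hc.mul_right_eq_zero).mp (e.trans ?_)
      rcases hm.refl_cases hM i with h3 | h3 | h3 | ⟨h0, h3, m', rfl, h4⟩
      · rw [h3.1, compVal_simple]
      · rw [compVal_zero j h3.1, hlow1, mul_zero]
      -- s_i cannot raise s_j v: (s_j v|α_i) = (v|α_i) + (v|α_j), where the integers on the right
      -- are at least -1 and 1. This is where the bound -2 < (v|α_i) is needed.
      · exfalso
        obtain ⟨zj, hzj⟩ := hv.form_int hM j
        have h4 := h3.1
        rw [form_refl, hg', hzi, hzj] at h4
        rw [hzj] at hj
        rw [hzi] at h1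
        have : zi - zj * (-1) < 0 := by exact_mod_cast h4
        have : 0 < zj := by exact_mod_cast hj
        have : -2 < zi := by exact_mod_cast h1
        omega
      · rw [compVal_pos j h0 h3, hlow m' (by omega) _ h4, mul_zero]
  -- Now α_i is the only simple root pairing positively with v, and the upper bound forces (v|α_i) =
  -- 1. A simple α_j pairing positively with s_i v must then be joined to α_i and orthogonal to v,
  -- so the equation for (i, j) at v reads d f_i(v) = b f_j(s_i v).
  · push Not at hj
    obtain ⟨k, hk⟩ := hv.exists_pos hs
    have hki : k = i := by
      by_contra hne
      exact absurd hk (hj k hne).not_gt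
    subst hki
    have hz : zi = 1 := by
      rw [hzi] at hk h2
      have : 0 < zi := by exact_mod_cast hk
      have : zi < 2 := by exact_mod_cast h2
      omega
    subst hz
    obtain ⟨m, rfl, hm⟩ := hv.descent hM (hs k) hk
    have hback : refl M k (refl M k v) = v := refl_refl M k v
    have hk1 : form M v (simple k) = 1 := by simpa using hzi
    have hneg : form M (refl M k v) (simple k) = -1 := by rw [form_refl_self, hk1]
    have hsu : ∀ l, refl M k v ≠ simple l := by
      intro l hl
      have hlk : gram M l k = -1 := by rw [← form_simple, ← hl, hneg]
      have hne : l ≠ k := by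
        rintro rfl
        rw [gram_self] at hlk
        norm_num at hlk
      have := hj l hne
      rw [← hback, hl, form_refl, form_simple, form_simple, gram_self, gram_symm M k l, hlk] at this
      norm_num at this
    obtain ⟨j, hj0⟩ := hm.exists_pos hsu
    have hjk : j ≠ k := by
      rintro rfl
      rw [hneg] at hj0
      norm_num at hj0
    have hj1 := hj j hjk
    have e1 : form M (refl M k v) (simple j) = form M v (simple j) - gram M k j := by
      rw [form_refl, hk1, one_mul]
    rcases hM.gram_cases k j with h | ⟨-, h, hg⟩ | ⟨-, h, hg⟩
    · exact absurd h.1.symm hjk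
    · rw [e1, hg] at hj0
      linarith
    · have hj2 : form M v (simple j) = 0 := by
        obtain ⟨z, hz⟩ := hv.form_int hM j
        rw [e1, hg, hz] at hj0
        rw [hz] at hj1 ⊢
        have h3 : 0 < z - (-1) := by exact_mod_cast hj0
        have h4 : z ≤ 0 := by exact_mod_cast hj1
        have h5 : z = 0 := by omega
        simp [h5]
      have e := hA.comp_of_three k j h _ v hv
      rw [compVal_zero k hj2, compVal_pos j (hs k) hk, hlow m (by omega) _ hm, mul_zero] at e
      exact (hd.mul_right_eq_zero).mp e

/-- The values of an LK-family at `α_i + δ` and `α_j + δ` agree if `m_{i,j} = 3` and `δ` is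
orthogonal to all the simple roots. -/
theorem LKEq.simple_add_eq (hM : IsSmall M) (hb : IsUnit b) (hA : LKEq M a b c d A) {i j : I}
    (h : M i j = 3) {δ : I → ℝ} (hδ : ∀ k, form M δ (simple k) = 0) {n : ℕ}
    (hL : Lev M n (simple i + δ)) :
    (∃ m, Lev M m (simple j + δ)) ∧ A i (simple i + δ) = A j (simple j + δ) := by
  have h' : M j i = 3 := by rw [M.symmetric, h]
  have hg := gram_of_three h
  have hg' := gram_of_three h'
  have e1 : refl M j (simple i + δ) = simple i + simple j + δ := by
    rw [map_add, refl_simple_of_three h, refl_eq_self (hδ j)]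
  have e2 : refl M i (simple j + δ) = simple i + simple j + δ := by
    rw [map_add, refl_simple_of_three h', refl_eq_self (hδ i), add_comm (simple j)]
  have hu : Lev M (n + 1) (simple i + simple j + δ) := by
    rw [← e1]
    exact hL.raise j (by rw [map_add, LinearMap.add_apply, form_simple, hg, hδ]; norm_num)
  have f1 : form M (simple i + simple j + δ) (simple j) = 1 := by
    simp only [map_add, LinearMap.add_apply, form_simple, hg, gram_self, hδ]; norm_num
  have f2 : form M (simple i + simple j + δ) (simple i) = 1 := by
    simp only [map_add, LinearMap.add_apply, form_simple, hg', gram_self, hδ]; norm_num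
  have n1 : simple i + simple j + δ ≠ simple j := by
    rintro h
    rw [h, form_simple, gram_self] at f1
    norm_num at f1
  have n2 : simple i + simple j + δ ≠ simple i := by
    rintro h
    rw [h, form_simple, gram_self] at f2
    norm_num at f2
  -- The root α_i + α_j + δ is both s_j(α_i + δ) and s_i(α_j + δ), so the equation there is b
  -- f_i(α_i + δ) = b f_j(α_j + δ).
  have e := hA.comp_of_three i j h _ _ hu
  rw [compVal_pos i n1 (by rw [f1]; norm_num), compVal_pos j n2 (by rw [f2]; norm_num),
    ← e1, refl_refl, e1, ← e2, refl_refl] at e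
  obtain ⟨m, hm⟩ := hu.refl_of_ne hM n2
  rw [← e2, refl_refl] at hm
  exact ⟨⟨m, hm⟩, hb.mul_left_cancel e⟩

end LKEq

theorem IsIrreducible.forall_of_edge (hM : IsSmall M) (h : IsIrreducible M) {P : I → Prop}
    (hP : ∀ i j, M i j = 3 → P i → P j) {i : I} (hi : P i) (j : I) : P j := by
  obtain ⟨p⟩ := h.preconnected i j
  induction p with
  | nil => exact hi
  | @cons u v w huv _ ih =>
    refine ih (hP u v ?_ hi)
    rcases hM.cases u v with h | h | h
    · exact absurd h huv.1
    · exact absurd h huv.2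
    · exact h

/-! ### The spherical case: an averaged inner product. -/

section Spherical

/-- The standard inner product averaged over the Coxeter group. -/
noncomputable def avgForm (M : CoxeterMatrix I) [Fintype M.Group] (v w : I → ℝ) : ℝ :=
  ∑ g : M.Group, act M g v ⬝ᵥ act M g w

variable [Fintype M.Group]

theorem avgForm_refl (i : I) (v w : I → ℝ) :
    avgForm M (refl M i v) (refl M i w) = avgForm M v w := by
  rw [avgForm, avgForm, ← Equiv.sum_comp (Equiv.mulRight (M.toCoxeterSystem.simple i))
    fun g => act M g v ⬝ᵥ act M g w]
  simp only [Equiv.coe_mulRight, map_mul, act_simple, LinearEquiv.mul_apply]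

theorem avgForm_add_smul (v w : I → ℝ) (r : ℝ) :
    avgForm M (v + r • w) (v + r • w) =
      avgForm M v v + 2 * r * avgForm M v w + r ^ 2 * avgForm M w w := by
  simp only [avgForm, Finset.mul_sum, ← Finset.sum_add_distrib]
  refine Finset.sum_congr rfl fun g _ => ?_
  simp only [map_add, map_smul, add_dotProduct, dotProduct_add, smul_dotProduct, dotProduct_smul,
    dotProduct_comm (act M g w) (act M g v), smul_eq_mul]
  ring

theorem eq_zero_of_avgForm_nonpos {v : I → ℝ} (h : avgForm M v v ≤ 0) : v = 0 := by
  have h0 : ∀ g ∈ Finset.univ, 0 ≤ act M g v ⬝ᵥ act M g v := fun g _ =>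
    Finset.sum_nonneg fun k _ => mul_self_nonneg _
  have h1 := (Finset.sum_eq_zero_iff_of_nonneg h0).mp (le_antisymm h (Finset.sum_nonneg h0)) 1
    (Finset.mem_univ 1)
  rw [dotProduct_self_eq_zero] at h1
  simpa using h1

/-- s_i is an isometry of the averaged form and negates α_i, so the coefficient (v|α_i) must be the
one of the orthogonal reflection. -/
theorem avgForm_simple (i : I) (v : I → ℝ) :
    2 * avgForm M v (simple i) = form M v (simple i) * avgForm M (simple i) (simple i) := by
  have h1 := avgForm_refl (M := M) i v (simple i)
  have h2 : avgForm M (refl M i v) (refl M i (simple i)) =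
      -avgForm M v (simple i) + form M v (simple i) * avgForm M (simple i) (simple i) := by
    rw [refl_simple_self, refl_apply]
    simp only [avgForm, Finset.mul_sum, ← Finset.sum_add_distrib, ← Finset.sum_neg_distrib]
    refine Finset.sum_congr rfl fun g _ => ?_
    simp only [map_sub, map_smul, map_neg, sub_dotProduct, dotProduct_neg, smul_dotProduct,
      smul_eq_mul]
    ring
  linarith

theorem avgForm_comm (v w : I → ℝ) : avgForm M v w = avgForm M w v :=
  Finset.sum_congr rfl fun _ _ => dotProduct_comm _ _

/-- For joined k and l, `avgForm_simple` computes the inner product of α_k and α_l as -1/2 times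
either squared length; so lengths agree along edges, and reflections preserve them. -/
theorem Lev.avgForm_self {n : ℕ} {v : I → ℝ} (hM : IsSmall M) (hI : IsIrreducible M)
    (h : Lev M n v) (i : I) : avgForm M v v = avgForm M (LK.simple i) (LK.simple i) := by
  induction h with
  | simple j =>
    refine hI.forall_of_edge (P := fun j => avgForm M (LK.simple j) (LK.simple j) =
      avgForm M (LK.simple i) (LK.simple i)) hM (fun k l hkl hk => ?_) rfl j
    have h1 := avgForm_simple (M := M) k (LK.simple l)
    have h2 := avgForm_simple (M := M) l (LK.simple k)
    rw [avgForm_comm, form_simple, gram_symm, gram_of_three hkl] at h1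
    rw [form_simple, gram_of_three hkl] at h2
    linarith
  | raise j _ _ ih => rw [avgForm_refl, ih]

end Spherical

/-- A Cauchy–Schwarz argument: if N is the common squared length, v ± α_i has squared length N(2 ±
(v|α_i)), which is positive unless v = ∓α_i. -/
theorem Lev.form_lt_two (hM : IsSmall M) (hI : IsIrreducible M) (hS : IsSpherical M) {n : ℕ}
    {v : I → ℝ} (h : Lev M n v) {i : I} (hv : v ≠ LK.simple i) :
    -2 < form M v (LK.simple i) ∧ form M v (LK.simple i) < 2 := by
  have : Finite M.Group := hS
  have := Fintype.ofFinite M.Group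
  have h1 := avgForm_simple (M := M) i v
  have h2 := h.avgForm_self hM hI i
  have h3 := avgForm_add_smul (M := M) v (LK.simple i)
  have h4 : 0 < avgForm M (LK.simple i) (LK.simple i) := by
    by_contra! h0
    have := congrFun (eq_zero_of_avgForm_nonpos h0) i
    simp [LK.simple] at this
  constructor
  · by_contra! h5
    have h6 := eq_zero_of_avgForm_nonpos (M := M) (v := v + (1 : ℝ) • LK.simple i)
      (by rw [h3]; nlinarith)
    have h7 := congrFun h6 i
    have := h.nonneg i
    simp [LK.simple] at h7
    linarith
  · by_contra! h5
    have h6 := eq_zero_of_avgForm_nonpos (M := M) (v := v + (-1 : ℝ) • LK.simple i)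
      (by rw [h3]; nlinarith)
    exact hv (by rwa [neg_one_smul, ← sub_eq_add_neg, sub_eq_zero] at h6)

section LKEq

variable {a b c d : R} {A : I → (I → ℝ) → R}

/-- Induction on the depth, applied to the difference between the family and its transport. The
pairs not reached by `LKEq.eq_zero_of_lower` have v = α_i; there `LKEq.simple_add_eq` with δ = 0
propagates the value along edges. -/
theorem LKEq.invariant_of_spherical (hM : IsSmall M) (hI : IsIrreducible M) (hS : IsSpherical M)
    (hb : IsUnit b) (hc : IsUnit c) (hd : IsUnit d) (hA : LKEq M a b c d A) (g : aut M) {n : ℕ}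
    {v : I → ℝ} (hv : Lev M n v) (i : I) :
    A i v = A ((g : Equiv.Perm I) i) (LK.permE (g : Equiv.Perm I) v) := by
  have hB := hA.sub (hA.permE g)
  rw [← sub_eq_zero]
  induction n using Nat.strong_induction_on generalizing v i with
  | _ n ih =>
  by_cases h : v = simple i
  · subst h
    rw [permE_simple, sub_eq_zero]
    refine (hI.forall_of_edge (P := fun j => A j (simple j) = A i (simple i)) hM
      (fun k l hkl hk => ?_) rfl _).symm
    have := (hA.simple_add_eq hM hb hkl (δ := 0) (by simp)
      (by rw [add_zero]; exact Lev.simple k)).2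
    rw [add_zero, add_zero] at this
    exact this.symm.trans hk
  · have := hv.form_lt_two hM hI hS h
    exact hB.eq_zero_of_lower hM hc hd (fun m hm w hw k => ih m hm hw k) hv this.1 this.2

end LKEq

/-! ### The affine case: a positive null vector. -/

section Affine

variable {δ : I → ℝ}

/-- On expanding the squares, the terms in v_i² and v_j² disappear because every row of the Gram
matrix kills δ. As off-diagonal Gram entries are nonpositive in small type, the formula exhibits the
form as positive semidefinite. -/
theorem form_self_eq_sum (hpos : ∀ i, 0 < δ i) (hδ : ∀ i, form M δ (simple i) = 0) (v : I → ℝ) :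
    form M v v = -(1 / 2) * ∑ i, ∑ j, gram M i j * (δ i * δ j) * (v i / δ i - v j / δ j) ^ 2 := by
  have hrow : ∀ i, ∑ j, gram M i j * δ j = 0 := by
    intro i
    have := hδ i
    simp only [form, Matrix.toBilin'_apply, simple] at this
    rw [← this]
    refine Finset.sum_congr rfl fun j _ => ?_
    simp [Pi.single_apply, gram_symm M i j, mul_comm]
  have h1 : ∀ i j, gram M i j * (δ i * δ j) * (v i / δ i - v j / δ j) ^ 2 =
      v i ^ 2 / δ i * (gram M i j * δ j) + v j ^ 2 / δ j * (gram M j i * δ i)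
        - 2 * (v i * gram M i j * v j) := by
    intro i j
    have := (hpos i).ne'
    have := (hpos j).ne'
    rw [gram_symm M j i]
    field_simp
    ring
  simp only [h1, Finset.sum_sub_distrib, Finset.sum_add_distrib]
  rw [Finset.sum_comm (f := fun i j => v j ^ 2 / δ j * (gram M j i * δ i))]
  simp only [← Finset.mul_sum, hrow, mul_zero, Finset.sum_const_zero]
  simp only [form, Matrix.toBilin'_apply]
  ring

theorem gram_mul_sq_nonpos (hM : IsSmall M) (hpos : ∀ i, 0 < δ i) (v : I → ℝ) (i j : I) :
    gram M i j * (δ i * δ j) * (v i / δ i - v j / δ j) ^ 2 ≤ 0 := by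
  have := mul_pos (hpos i) (hpos j)
  rcases hM.gram_cases i j with ⟨rfl, -⟩ | ⟨-, -, h⟩ | ⟨-, -, h⟩
  · simp
  · simp [h]
  · rw [h]
    nlinarith [mul_nonneg this.le (sq_nonneg (v i / δ i - v j / δ j))]

/-- All terms of the sum of squares have the same sign, so each vanishes; the ratio v_i/δ_i is
therefore constant along edges. -/
theorem eq_smul_of_form_nonpos (hM : IsSmall M) (hI : IsIrreducible M) (hpos : ∀ i, 0 < δ i)
    (hδ : ∀ i, form M δ (simple i) = 0) {v : I → ℝ} (h : form M v v ≤ 0) : ∃ k : ℝ, v = k • δ := by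
  have hs := form_self_eq_sum hpos hδ v
  have hle := gram_mul_sq_nonpos hM hpos v
  have h1 : ∑ i, ∑ j, gram M i j * (δ i * δ j) * (v i / δ i - v j / δ j) ^ 2 = 0 :=
    le_antisymm (Finset.sum_nonpos fun i _ => Finset.sum_nonpos fun j _ => hle i j) (by linarith)
  have h2 : ∀ i j, gram M i j * (δ i * δ j) * (v i / δ i - v j / δ j) ^ 2 = 0 := by
    intro i j
    have h3 := (Finset.sum_eq_zero_iff_of_nonpos
      fun i _ => Finset.sum_nonpos fun j _ => hle i j).mp h1 i (Finset.mem_univ i)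
    exact (Finset.sum_eq_zero_iff_of_nonpos fun j _ => hle i j).mp h3 j (Finset.mem_univ j)
  obtain ⟨o⟩ := hI.nonempty
  refine ⟨v o / δ o, ?_⟩
  ext i
  have h3 : v i / δ i = v o / δ o := by
    refine hI.forall_of_edge (P := fun i => v i / δ i = v o / δ o) hM (fun k l hkl hk => ?_) rfl i
    have h4 := h2 k l
    rw [gram_of_three hkl] at h4
    have h5 : v k / δ k - v l / δ l = 0 := by
      have := (hpos k).ne'
      have := (hpos l).ne'
      simpa [*] using h4
    linarith
  rw [Pi.smul_apply, smul_eq_mul, ← h3, div_mul_cancel₀ _ (hpos i).ne']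

/-- The image of δ is isotropic, hence a multiple of δ, and the sum of coordinates is preserved and
positive. -/
theorem permE_null (hM : IsSmall M) (hI : IsIrreducible M) (hpos : ∀ i, 0 < δ i)
    (hδ : ∀ i, form M δ (simple i) = 0) (g : aut M) : permE (g : Equiv.Perm I) δ = δ := by
  have h0 : form M δ δ ≤ 0 := by
    rw [form_self_eq_sum hpos hδ δ]
    simp [fun i => (hpos i).ne']
  obtain ⟨k, hk⟩ := eq_smul_of_form_nonpos hM hI hpos hδ (v := permE (g : Equiv.Perm I) δ)
    (by rwa [form_permE])
  obtain ⟨o⟩ := hI.nonempty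
  have h1 : ∑ i, permE (g : Equiv.Perm I) δ i = ∑ i, δ i :=
    Equiv.sum_comp (g : Equiv.Perm I).symm δ
  have h2 : 0 < ∑ i, δ i := Finset.sum_pos (fun i _ => hpos i) ⟨o, Finset.mem_univ o⟩
  rw [hk] at h1
  simp only [Pi.smul_apply, smul_eq_mul, ← Finset.mul_sum] at h1
  have h3 : k = 1 := by
    apply mul_right_cancel₀ h2.ne'
    rw [h1, one_mul]
  rw [hk, h3, one_smul]

variable {a b c d : R} {A : I → (I → ℝ) → R}

/-- Both δ - α_i and δ - α_j are raised from the same root δ - α_i - α_j. The equation for (i, j) at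
that root compares their coefficients up to terms of lower depth. -/
theorem LKEq.sub_simple_eq (hM : IsSmall M) (hA : LKEq M a b c d A) {i j : I} (h : M i j = 3)
    (hδ : ∀ k, form M δ (simple k) = 0) {n : ℕ} (hL : Lev M n (δ - simple i)) :
    Lev M n (δ - simple j) ∧ ∃ m < n, Lev M m (δ - simple i - simple j) ∧
      a * A i (δ - simple i - simple j) + c * A i (δ - simple i) =
        a * A j (δ - simple i - simple j) + c * A j (δ - simple j) := by
  have h' : M j i = 3 := by rw [M.symmetric, h]
  have hg := gram_of_three h
  have hg' := gram_of_three h'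
  have f1 : form M (δ - simple i) (simple j) = 1 := by
    simp only [map_sub, LinearMap.sub_apply, form_simple, hg, hδ]; norm_num
  have n1 : δ - simple i ≠ simple j := by
    intro h
    rw [h, form_simple, gram_self] at f1
    norm_num at f1
  have e1 : refl M j (δ - simple i) = δ - simple i - simple j := by
    rw [refl_apply, f1, one_smul]
  obtain ⟨m, rfl, hm⟩ := hL.descent hM n1 (by rw [f1]; norm_num)
  rw [e1] at hm
  have f2 : form M (δ - simple i - simple j) (simple i) = -1 := by
    simp only [map_sub, LinearMap.sub_apply, form_simple, gram_self, hg', hδ]; norm_num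
  have f3 : form M (δ - simple i - simple j) (simple j) = -1 := by
    simp only [map_sub, LinearMap.sub_apply, form_simple, gram_self, hg, hδ]; norm_num
  have e2 : refl M i (δ - simple i - simple j) = δ - simple j := by
    rw [refl_apply, f2]
    module
  have e3 : refl M j (δ - simple i - simple j) = δ - simple i := by
    rw [refl_apply, f3]
    module
  have h1 := hm.raise i (by rw [f2]; norm_num)
  rw [e2] at h1
  have e := hA.comp_of_three i j h _ _ hm
  rw [compVal_neg i (by rw [f3]; norm_num), compVal_neg j (by rw [f2]; norm_num), e2, e3] at e
  exact ⟨h1, m, by omega, hm, e⟩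

/-- An automorphism fixing a vertex or inverting an edge. -/
def FixesOrFlips (M : CoxeterMatrix I) (g : aut M) : Prop :=
  ∃ i, (g : Equiv.Perm I) i = i ∨
    M i ((g : Equiv.Perm I) i) = 3 ∧ (g : Equiv.Perm I) ((g : Equiv.Perm I) i) = i

/-- If |(v|α_i)| ≥ 2, then v - α_i or v + α_i has nonpositive norm, hence is a multiple of δ. These
two families of roots are treated by hand, all other pairs by `LKEq.eq_zero_of_lower`. -/
theorem LKEq.invariant_of_null (hM : IsSmall M) (hI : IsIrreducible M) (hpos : ∀ i, 0 < δ i)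
    (hδ : ∀ i, form M δ (simple i) = 0)
    (haut : ∃ o, ∀ g : aut M, ∃ ρ : aut M, FixesOrFlips M ρ ∧
      (ρ : Equiv.Perm I) ((g : Equiv.Perm I) o) = o)
    (hb : IsUnit b) (hc : IsUnit c) (hd : IsUnit d) (hA : LKEq M a b c d A) {n : ℕ}
    {v : I → ℝ} (hv : Lev M n v) (i : I) (g : aut M) :
    A i v = A ((g : Equiv.Perm I) i) (LK.permE (g : Equiv.Perm I) v) := by
  induction n using Nat.strong_induction_on generalizing v i g with
  | _ n ih =>
  have hnull : ∀ k : ℝ, ∀ i, form M (k • δ) (simple i) = 0 := fun k i => by simp [hδ]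
  have hperm : ∀ k : ℝ, ∀ g : aut M, LK.permE (g : Equiv.Perm I) (k • δ) = k • δ := fun k g => by
    rw [map_smul, permE_null hM hI hpos hδ g]
  by_cases h1 : 2 ≤ form M v (simple i)
  · obtain ⟨k, hk⟩ := eq_smul_of_form_nonpos hM hI hpos hδ (v := v - simple i) (by
      simp only [map_sub, LinearMap.sub_apply, hv.norm, form_simple, gram_self,
        form_comm M (simple i) v]
      linarith)
    obtain rfl : v = simple i + k • δ := by rw [← hk]; abel
    rw [map_add, permE_simple, hperm]
    refine (hI.forall_of_edge (P := fun j => (∃ m, Lev M m (simple j + k • δ)) ∧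
      A j (simple j + k • δ) = A i (simple i + k • δ)) hM
      (fun j l hjl hj => ?_) ⟨⟨n, hv⟩, rfl⟩ _).2.symm
    obtain ⟨⟨m, hm⟩, hj⟩ := hj
    obtain ⟨h2, h3⟩ := hA.simple_add_eq hM hb hjl (hnull k) hm
    exact ⟨h2, h3.symm.trans hj⟩
  by_cases h2 : form M v (simple i) ≤ -2
  · obtain ⟨k, hk⟩ := eq_smul_of_form_nonpos hM hI hpos hδ (v := v + simple i) (by
      simp only [map_add, LinearMap.add_apply, hv.norm, form_simple, gram_self,
        form_comm M (simple i) v]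
      linarith)
    obtain rfl : v = k • δ - simple i := by rw [← hk]; abel
    rw [map_sub, permE_simple, hperm]
    have hlev : ∀ j, Lev M n (k • δ - simple j) := hI.forall_of_edge
      (P := fun j => Lev M n (k • δ - simple j)) hM
      (fun j l hjl hj => (hA.sub_simple_eq hM hjl (hnull k) hj).1) hv
    -- The discrepancy of ρ does not depend on the vertex: along an edge its variation is made of
    -- coefficients of lower depth, which are already invariant.
    have hconst : ∀ (ρ : aut M) (j l : I),
        A j (k • δ - simple j) - A ((ρ : Equiv.Perm I) j) (k • δ - simple ((ρ : Equiv.Perm I) j)) =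
        A l (k • δ - simple l) -
          A ((ρ : Equiv.Perm I) l) (k • δ - simple ((ρ : Equiv.Perm I) l)) := by
      intro ρ j l
      refine hI.forall_of_edge (P := fun l =>
        A j (k • δ - simple j) - A ((ρ : Equiv.Perm I) j) (k • δ - simple ((ρ : Equiv.Perm I) j)) =
        A l (k • δ - simple l) -
          A ((ρ : Equiv.Perm I) l) (k • δ - simple ((ρ : Equiv.Perm I) l)))
        hM (fun p q hpq hp => hp.trans ?_) rfl l
      obtain ⟨-, m, hmn, hm, e1⟩ := hA.sub_simple_eq hM hpq (hnull k) (hlev p)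
      obtain ⟨-, -, -, -, e2⟩ :=
        hA.sub_simple_eq hM ((ρ.2 p q).trans hpq) (hnull k) (hlev ((ρ : Equiv.Perm I) p))
      have e3 := ih m hmn hm p ρ
      have e4 := ih m hmn hm q ρ
      rw [map_sub, map_sub, hperm, permE_simple, permE_simple] at e3 e4
      apply hc.mul_left_cancel
      linear_combination e1 - e2 - a * e3 + a * e4
    have hgood : ∀ ρ : aut M, FixesOrFlips M ρ → ∀ j, A j (k • δ - simple j) =
        A ((ρ : Equiv.Perm I) j) (k • δ - simple ((ρ : Equiv.Perm I) j)) := by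
      intro ρ hρ j
      obtain ⟨p, hp⟩ := hρ
      rw [← sub_eq_zero, hconst ρ j p, sub_eq_zero]
      rcases hp with hp | ⟨hp, hpp⟩
      · rw [hp]
      -- ρ flips the edge {p, ρ(p)}, so it fixes kδ - α_p - α_{ρ(p)}; by induction the lower terms
      -- on the two sides of the edge equation are equal and cancel.
      · obtain ⟨-, m, hmn, hm, e1⟩ := hA.sub_simple_eq hM hp (hnull k) (hlev p)
        have e3 := ih m hmn hm p ρ
        rw [map_sub, map_sub, hperm, permE_simple, permE_simple, hpp,
          sub_right_comm (k • δ) (simple ((ρ : Equiv.Perm I) p))] at e3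
        apply hc.mul_left_cancel
        linear_combination e1 - a * e3
    obtain ⟨o, ho⟩ := haut
    -- The discrepancy of g is computed at o: ρ has none, so the coefficient at g(o) equals the one
    -- at ρ(g(o)) = o.
    obtain ⟨ρ, hρ, hρg⟩ := ho g
    have e := hgood ρ hρ ((g : Equiv.Perm I) o)
    rw [hρg] at e
    rw [← sub_eq_zero, hconst g i o, e, sub_self]
  · rw [← sub_eq_zero]
    exact (hA.sub (hA.permE g)).eq_zero_of_lower hM hc hd
      (fun m hm w hw k => sub_eq_zero.mpr (ih m hm hw k g)) hv (by linarith) (by linarith)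

end Affine

/-! ### The extended Dynkin graphs. -/

section Graph

/-- The properties of the extended Dynkin graphs that imply the invariance of LK-families: there is
a positive integral null vector, and some vertex can be brought back from any of its images by an
automorphism fixing a vertex or inverting an edge. -/
structure IsAffineGraph {X : Type*} [Fintype X] (G : SimpleGraph X) [DecidableRel G.Adj] :
    Prop where
  connected : G.Connected
  exists_null : ∃ δ : X → ℕ, (∀ x, 0 < δ x) ∧
    ∀ x, ∑ y, (if G.Adj x y then δ y else 0) = 2 * δ x
  exists_aut : ∃ o, ∀ g : G ≃g G, ∃ ρ : G ≃g G,
    (∃ i, ρ i = i ∨ G.Adj i (ρ i) ∧ ρ (ρ i) = i) ∧ ρ (g o) = o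

theorem connected_of_rank {X : Type*} {G : SimpleGraph X} (o : X) (r : X → ℕ)
    (h : ∀ x, x = o ∨ ∃ y, G.Adj x y ∧ r y < r x) : G.Connected := by
  have key : ∀ n x, r x = n → G.Reachable x o := by
    intro n
    induction n using Nat.strong_induction_on with
    | _ n ih =>
    rintro x rfl
    rcases h x with rfl | ⟨y, hxy, hy⟩
    · exact SimpleGraph.Reachable.refl _
    · exact hxy.reachable.trans (ih _ hy y rfl)
  have : Nonempty X := ⟨o⟩
  exact ⟨fun x y => (key _ x rfl).trans (key _ y rfl).symm⟩

/-- A vertex that is alone in having its degree is fixed by every automorphism, so ρ can be the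
identity. For the three graphs of type E this vertex is the branch vertex. -/
theorem exists_aut_of_degree {X : Type*} [Fintype X] [DecidableEq X] {G : SimpleGraph X}
    [DecidableRel G.Adj] {k : ℕ} {o : X} (ho : G.degree o = k) (h : ∀ x, G.degree x = k → x = o) :
    ∃ o, ∀ g : G ≃g G, ∃ ρ : G ≃g G,
      (∃ i, ρ i = i ∨ G.Adj i (ρ i) ∧ ρ (ρ i) = i) ∧ ρ (g o) = o :=
  ⟨o, fun g => ⟨SimpleGraph.Iso.refl, ⟨o, Or.inl rfl⟩, h _ ((g.degree_eq o).trans ho)⟩⟩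

instance : DecidableRel affineE6.Adj := by unfold affineE6; infer_instance

instance : DecidableRel affineE7.Adj := by unfold affineE7; infer_instance

instance : DecidableRel affineE8.Adj := by unfold affineE8; infer_instance

instance (n : ℕ) : DecidableRel (affineD n).Adj := by unfold affineD; infer_instance

theorem isAffineGraph_affineE6 : IsAffineGraph affineE6 where
  connected := connected_of_rank 4 ![3, 2, 2, 1, 0, 1, 2] (by decide)
  -- The marks of the affine diagram: twice each mark is the sum of the neighbouring ones.
  exists_null := ⟨![1, 1, 2, 2, 3, 2, 1], by decide, by decide⟩
  exists_aut := exists_aut_of_degree (k := 3) (o := 4) (by decide) (by decide)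

theorem isAffineGraph_affineE7 : IsAffineGraph affineE7 where
  connected := connected_of_rank 4 ![3, 2, 1, 1, 0, 1, 2, 3] (by decide)
  exists_null := ⟨![1, 2, 2, 3, 4, 3, 2, 1], by decide, by decide⟩
  exists_aut := exists_aut_of_degree (k := 3) (o := 4) (by decide) (by decide)

theorem isAffineGraph_affineE8 : IsAffineGraph affineE8 where
  connected := connected_of_rank 4 ![5, 2, 1, 1, 0, 1, 2, 3, 4] (by decide)
  exists_null := ⟨![1, 2, 3, 4, 6, 5, 4, 3, 2], by decide, by decide⟩
  exists_aut := exists_aut_of_degree (k := 3) (o := 4) (by decide) (by decide)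

theorem isAffineGraph_cycleGraph (n : ℕ) :
    IsAffineGraph (SimpleGraph.cycleGraph (n + 3)) where
  connected := SimpleGraph.cycleGraph_connected
  exists_null := by
    refine ⟨fun _ => 1, fun _ => one_pos, fun x => ?_⟩
    rw [Finset.sum_boole, ← SimpleGraph.neighborFinset_eq_filter,
      SimpleGraph.card_neighborFinset_eq_degree, SimpleGraph.cycleGraph_degree_three_le]
    rfl
  exists_aut := by
    refine ⟨0, fun g => ?_⟩
    -- The reflection of the cycle exchanging 0 and g(0). According to whether g(0) is 2m or 2m + 1,
    -- it fixes m or flips the edge {m, m + 1}. It is needed because rotations may have neither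
    -- fixed vertex nor flipped edge.
    let ρ : SimpleGraph.cycleGraph (n + 3) ≃g SimpleGraph.cycleGraph (n + 3) :=
      { toEquiv := Equiv.subLeft (g 0)
        map_rel_iff' := by
          intro x y
          rw [SimpleGraph.cycleGraph_adj, SimpleGraph.cycleGraph_adj]
          simp only [Equiv.subLeft_apply, sub_sub_sub_cancel_left]
          exact or_comm }
    have hρ : ∀ x, ρ x = g 0 - x := fun _ => rfl
    refine ⟨ρ, ?_, by rw [hρ, sub_self]⟩
    have hlt := (g 0 : Fin (n + 3)).isLt
    rcases Nat.even_or_odd' ((g 0 : Fin (n + 3)) : ℕ) with ⟨m, hm | hm⟩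
    · have h1 : g 0 = (⟨m, by omega⟩ + ⟨m, by omega⟩ : Fin (n + 3)) := by
        rw [Fin.ext_iff, Fin.val_add, Nat.mod_eq_of_lt (by dsimp only; omega), hm]
        dsimp only
        omega
      exact ⟨⟨m, by omega⟩, Or.inl (by rw [hρ, h1, add_sub_cancel_right])⟩
    · have h1 : g 0 = (⟨m, by omega⟩ + ⟨m, by omega⟩ + 1 : Fin (n + 3)) := by
        rw [Fin.ext_iff, Fin.val_add, Fin.val_add, Nat.mod_eq_of_lt (b := n + 3) (a := m + m)
          (by omega), Fin.val_one, Nat.mod_eq_of_lt (by omega), hm]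
        omega
      refine ⟨⟨m, by omega⟩, Or.inr ⟨?_, by rw [hρ, hρ, sub_sub_cancel]⟩⟩
      rw [hρ, SimpleGraph.cycleGraph_adj, h1]
      exact Or.inr (by abel)

theorem affineD_adj {n : ℕ} {x y : Fin (n + 1)} :
    (affineD n).Adj x y ↔ (x : ℕ) ≠ y ∧
      (((x : ℕ) = 0 ∧ (y : ℕ) = 2 ∨ 1 ≤ (x : ℕ) ∧ (x : ℕ) + 1 = y ∧ (y : ℕ) + 1 ≤ n ∨
        (x : ℕ) + 2 = n ∧ (y : ℕ) = n) ∨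
      ((y : ℕ) = 0 ∧ (x : ℕ) = 2 ∨ 1 ≤ (y : ℕ) ∧ (y : ℕ) + 1 = x ∧ (x : ℕ) + 1 ≤ n ∨
        (y : ℕ) + 2 = n ∧ (x : ℕ) = n)) := by
  rw [affineD, SimpleGraph.fromRel_adj, ne_eq, Fin.ext_iff]

theorem affineD_sum {n : ℕ} (f : Fin (n + 1) → ℕ) (x : Fin (n + 1)) (s : Finset (Fin (n + 1)))
    (h : ∀ y, (affineD n).Adj x y ↔ y ∈ s) :
    ∑ y, (if (affineD n).Adj x y then f y else 0) = ∑ y ∈ s, f y := by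
  simp only [h, Finset.sum_ite_mem, Finset.univ_inter]

/-- Only 2 and n - 2 can have three neighbours, so an automorphism sends the vertex 2 to one of
them. -/
theorem affineD_adj_of_ne {n : ℕ} {x : Fin (n + 1)} (h2 : (x : ℕ) ≠ 2) (hn : (x : ℕ) + 2 ≠ n) :
    ∃ p q : ℕ, ∀ y : Fin (n + 1), (affineD n).Adj x y → (y : ℕ) = p ∨ (y : ℕ) = q := by
  by_cases h0 : (x : ℕ) = 0
  · exact ⟨2, 2, fun y hy => by rw [affineD_adj] at hy; omega⟩
  by_cases h1 : (x : ℕ) = n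
  · exact ⟨n - 2, n - 2, fun y hy => by rw [affineD_adj] at hy; omega⟩
  · exact ⟨x - 1, x + 1, fun y hy => by rw [affineD_adj] at hy; omega⟩

theorem isAffineGraph_affineD {n : ℕ} (hn : 4 ≤ n) : IsAffineGraph (affineD n) where
  connected := by
    refine connected_of_rank ⟨1, by omega⟩ (fun x => if (x : ℕ) = 0 then 3 else x) fun x => ?_
    rcases x with ⟨x, hx⟩
    by_cases h0 : x = 0
    · exact Or.inr ⟨⟨2, by omega⟩, affineD_adj.mpr (by dsimp only; omega), by simp [h0]⟩
    by_cases h1 : x = 1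
    · exact Or.inl (by simp [h1])
    by_cases h2 : x = n
    · refine Or.inr ⟨⟨n - 2, by omega⟩, affineD_adj.mpr (by dsimp only; omega), ?_⟩
      simp only [h0, if_false]
      split_ifs <;> omega
    · refine Or.inr ⟨⟨x - 1, by omega⟩, affineD_adj.mpr (by dsimp only; omega), ?_⟩
      simp only [h0, if_false]
      split_ifs <;> omega
  exists_null := by
    -- Marks: 1 at the four leaves and 2 on the chain from 2 to n - 2.
    refine ⟨fun x => if 2 ≤ (x : ℕ) ∧ (x : ℕ) + 2 ≤ n then 2 else 1, fun x => ?_, fun x => ?_⟩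
    · dsimp only
      split_ifs <;> norm_num
    rcases x with ⟨x, hx⟩
    by_cases h0 : x ≤ 1
    · rw [affineD_sum _ _ {⟨2, by omega⟩}
        (fun y => by
          rw [affineD_adj]
          simp only [Finset.mem_singleton, Fin.ext_iff]
          omega), Finset.sum_singleton]
      dsimp only
      rw [if_pos (by omega), if_neg (by omega)]
    by_cases h1 : n ≤ x + 1
    · rw [affineD_sum _ _ {⟨n - 2, by omega⟩}
        (fun y => by
          rw [affineD_adj]
          simp only [Finset.mem_singleton, Fin.ext_iff]
          omega), Finset.sum_singleton]
      dsimp only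
      rw [if_pos (by omega), if_neg (by omega)]
    -- For n = 4 the two branch vertices coincide and there are four neighbours, so the sums below
    -- do not apply.
    by_cases h2 : n = 4
    · subst h2
      obtain rfl : x = 2 := by omega
      clear h0 h1 hn
      revert hx
      decide
    by_cases h3 : x = 2
    · rw [affineD_sum _ _ {⟨0, by omega⟩, ⟨1, by omega⟩, ⟨3, by omega⟩}
        (fun y => by
          rw [affineD_adj]
          simp only [Finset.mem_insert, Finset.mem_singleton, Fin.ext_iff]
          omega),
        Finset.sum_insert (by
          simp only [Finset.mem_insert, Finset.mem_singleton, Fin.ext_iff]; omega), Finset.sum_insert (by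
          simp only [Finset.mem_singleton, Fin.ext_iff]; omega), Finset.sum_singleton]
      dsimp only
      rw [if_neg (by omega), if_neg (by omega), if_pos (by omega), if_pos (by omega)]
      norm_num
    by_cases h4 : x + 2 = n
    · rw [affineD_sum _ _ {⟨n - 3, by omega⟩, ⟨n - 1, by omega⟩, ⟨n, by omega⟩}
        (fun y => by
          rw [affineD_adj]
          simp only [Finset.mem_insert, Finset.mem_singleton, Fin.ext_iff]
          omega),
        Finset.sum_insert (by
          simp only [Finset.mem_insert, Finset.mem_singleton, Fin.ext_iff]; omega), Finset.sum_insert (by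
          simp only [Finset.mem_singleton, Fin.ext_iff]; omega),
        Finset.sum_singleton]
      dsimp only
      rw [if_pos (by omega), if_neg (by omega), if_neg (by omega), if_pos (by omega)]
      norm_num
    · rw [affineD_sum _ _ {⟨x - 1, by omega⟩, ⟨x + 1, by omega⟩}
        (fun y => by
          rw [affineD_adj]
          simp only [Finset.mem_insert, Finset.mem_singleton, Fin.ext_iff]
          omega),
        Finset.sum_insert (by
          simp only [Finset.mem_singleton, Fin.ext_iff]; omega), Finset.sum_singleton]
      dsimp only
      rw [if_pos (by omega), if_pos (by omega), if_pos (by omega)]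
  exists_aut := by
    refine ⟨⟨2, by omega⟩, fun g => ?_⟩
    -- The reversal x ↦ n - x exchanges 2 and n - 2, and fixes the middle vertex or flips the middle
    -- edge according to the parity of n.
    let ρ : affineD n ≃g affineD n :=
      { toEquiv := Fin.revPerm
        map_rel_iff' := by
          intro x y
          rw [affineD_adj, affineD_adj]
          simp only [Fin.revPerm_apply, Fin.val_rev]
          omega }
    have hρ : ∀ x, ((ρ x : Fin (n + 1)) : ℕ) = n - x := fun x => by
      change ((Fin.rev x : Fin (n + 1)) : ℕ) = n - x
      rw [Fin.val_rev]
      omega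
    have hadj : ∀ k (hk : k < n + 1), k = 0 ∨ k = 1 ∨ k = 3 →
        (affineD n).Adj (g ⟨2, by omega⟩) (g ⟨k, hk⟩) := fun k hk h =>
      (g.map_adj_iff).mpr (affineD_adj.mpr (by dsimp only; omega))
    have hne : ∀ k l (hk : k < n + 1) (hl : l < n + 1), k ≠ l →
        ((g ⟨k, hk⟩ : Fin (n + 1)) : ℕ) ≠ (g ⟨l, hl⟩ : Fin (n + 1)) := fun k l hk hl hkl h =>
      hkl (by simpa using g.injective (Fin.ext h))
    have h01 := hne 0 1 (by omega) (by omega) (by omega)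
    have h03 := hne 0 3 (by omega) (by omega) (by omega)
    have h13 := hne 1 3 (by omega) (by omega) (by omega)
    have h2 : ((g ⟨2, by omega⟩ : Fin (n + 1)) : ℕ) = 2 ∨
        ((g ⟨2, by omega⟩ : Fin (n + 1)) : ℕ) + 2 = n := by
      by_contra! h
      obtain ⟨p, q, hpq⟩ := affineD_adj_of_ne h.1 h.2
      have a0 := hpq _ (hadj 0 (by omega) (by omega))
      have a1 := hpq _ (hadj 1 (by omega) (by omega))
      have a3 := hpq _ (hadj 3 (by omega) (by omega))
      omega
    rcases h2 with h2 | h2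
    · exact ⟨SimpleGraph.Iso.refl, ⟨g ⟨2, by omega⟩, Or.inl rfl⟩, Fin.ext h2⟩
    · refine ⟨ρ, ?_, Fin.ext (by rw [hρ]; dsimp only; omega)⟩
      rcases Nat.even_or_odd' n with ⟨m, hm | hm⟩
      · exact ⟨⟨m, by omega⟩, Or.inl (Fin.ext (by rw [hρ]; dsimp only; omega))⟩
      · refine ⟨⟨m, by omega⟩, Or.inr ⟨affineD_adj.mpr ?_, Fin.ext ?_⟩⟩
        · rw [hρ]; dsimp only; omega
        · rw [hρ, hρ]; dsimp only; omega

end Graph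

theorem graph_adj_iff (hM : IsSmall M) {i j : I} : (graph M).Adj i j ↔ M i j = 3 := by
  constructor
  · intro h
    rcases hM.cases i j with h' | h' | h'
    · exact absurd h' h.1
    · exact absurd h' h.2
    · exact h'
  · intro h
    exact ⟨ne_of_three h, by omega⟩

theorem form_simple_right (M : CoxeterMatrix I) (v : I → ℝ) (i : I) :
    form M v (simple i) = ∑ j, v j * gram M i j := by
  simp only [form, Matrix.toBilin'_apply, simple]
  refine Finset.sum_congr rfl fun j _ => ?_
  simp [Pi.single_apply, gram_symm M i j]

/-- In small type the graph determines the matrix, so graph automorphisms and automorphisms of Γ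
correspond; the pairing of δ with α_i is twice δ_i minus the sum of δ over the neighbours of i. -/
theorem affine_data_of_iso (hM : IsSmall M) {X : Type*} [Fintype X] {G : SimpleGraph X}
    [DecidableRel G.Adj] (hG : IsAffineGraph G) (φ : graph M ≃g G) :
    IsIrreducible M ∧
    (∃ δ : I → ℝ, (∀ i, 0 < δ i) ∧ ∀ i, form M δ (simple i) = 0) ∧
    ∃ o, ∀ g : aut M, ∃ ρ : aut M, FixesOrFlips M ρ ∧
      (ρ : Equiv.Perm I) ((g : Equiv.Perm I) o) = o := by
  refine ⟨φ.connected_iff.mpr hG.connected, ?_, ?_⟩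
  · obtain ⟨δ, hpos, hδ⟩ := hG.exists_null
    refine ⟨fun i => δ (φ i), fun i => Nat.cast_pos.mpr (hpos _), fun i => ?_⟩
    have h1 := hδ (φ i)
    rw [← Equiv.sum_comp φ.toEquiv] at h1
    have h2 : ∀ j, (δ (φ j) : ℝ) * gram M i j = (if i = j then 2 * (δ (φ j) : ℝ) else 0) -
        (((if G.Adj (φ i) (φ j) then δ (φ j) else 0 : ℕ)) : ℝ) := by
      intro j
      have h3 : G.Adj (φ i) (φ j) ↔ M i j = 3 := φ.map_adj_iff.trans (graph_adj_iff hM)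
      rcases hM.gram_cases i j with ⟨rfl, hg⟩ | ⟨hne, h, hg⟩ | ⟨hne, h, hg⟩
      · simp [hg, mul_comm]
      · simp [hg, hne, h3, h]
      · simp [hg, hne, h3, h]
    rw [form_simple_right]
    simp only [h2, Finset.sum_sub_distrib, Finset.sum_ite_eq, Finset.mem_univ, if_true]
    rw [← Nat.cast_sum]
    erw [h1]
    push_cast
    ring
  · obtain ⟨o, ho⟩ := hG.exists_aut
    refine ⟨φ.symm o, fun g => ?_⟩
    let gM : graph M ≃g graph M :=
      { toEquiv := (g : Equiv.Perm I)
        map_rel_iff' := by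
          intro i j
          rw [graph_adj_iff hM, graph_adj_iff hM, g.2 i j] }
    obtain ⟨ρ, ⟨i, hi⟩, hρ⟩ := ho ((φ.symm.trans gM).trans φ)
    let ρM : graph M ≃g graph M := (φ.trans ρ).trans φ.symm
    have hρM : ∀ i j, M (ρM i) (ρM j) = M i j := by
      intro i j
      have h1 : M (ρM i) (ρM j) = 3 ↔ M i j = 3 := by
        rw [← graph_adj_iff hM, ← graph_adj_iff hM, ρM.map_adj_iff]
      have h2 : ρM i = ρM j ↔ i = j := ρM.injective.eq_iff
      rcases hM.cases (ρM i) (ρM j) with h | h | h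
      · rw [h2] at h
        subst h
        simp
      · rcases hM.cases i j with h' | h' | h'
        · exact absurd (h2.mpr h') (ne_of_two h)
        · rw [h, h']
        · rw [h1.mpr h', h']
      · rw [h, h1.mp h]
    refine ⟨⟨ρM.toEquiv, hρM⟩, ⟨φ.symm i, ?_⟩, ?_⟩
    · change φ.symm (ρ (φ (φ.symm i))) = φ.symm i ∨
        M (φ.symm i) (φ.symm (ρ (φ (φ.symm i)))) = 3 ∧
          φ.symm (ρ (φ (φ.symm (ρ (φ (φ.symm i)))))) = φ.symm i
      simp only [RelIso.apply_symm_apply]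
      rcases hi with hi | ⟨hi, hi'⟩
      · exact Or.inl (by rw [hi])
      · refine Or.inr ⟨?_, by rw [hi']⟩
        rw [← graph_adj_iff hM]
        exact φ.symm.map_adj_iff.mpr hi
    · change φ.symm (ρ (φ (gM (φ.symm o)))) = φ.symm o
      exact congrArg φ.symm hρ

theorem IsAffine.data (h : IsAffine M) :
    IsIrreducible M ∧
    (∃ δ : I → ℝ, (∀ i, 0 < δ i) ∧ ∀ i, form M δ (simple i) = 0) ∧
    ∃ o, ∀ g : aut M, ∃ ρ : aut M, FixesOrFlips M ρ ∧
      (ρ : Equiv.Perm I) ((g : Equiv.Perm I) o) = o := by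
  obtain ⟨hM, ⟨n, hn, ⟨φ⟩⟩ | ⟨n, hn, ⟨φ⟩⟩ | ⟨⟨φ⟩⟩ | ⟨⟨φ⟩⟩ | ⟨⟨φ⟩⟩⟩ := h
  · obtain ⟨m, rfl⟩ := Nat.exists_eq_add_of_le' hn
    exact affine_data_of_iso hM (isAffineGraph_cycleGraph m) φ
  · exact affine_data_of_iso hM (isAffineGraph_affineD hn) φ
  · exact affine_data_of_iso hM isAffineGraph_affineE6 φ
  · exact affine_data_of_iso hM isAffineGraph_affineE7 φ
  · exact affine_data_of_iso hM isAffineGraph_affineE8 φ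

/-! ### The normalised recursion and its confluence in rank 3. -/

open scoped Classical in
/-- The right-hand side of the normalised recursion for the coefficient `G_{i,v}`, using the
simple reflection `s_j`. -/
noncomputable def ruleVal (M : CoxeterMatrix I) (q : R) (G : I → (I → ℝ) → R) (i j : I)
    (v : I → ℝ) : R :=
  if M i j = 2 then G i (refl M j v)
  else if 0 < form M (refl M j v) (simple i) then q * G j (refl M i (refl M j v))
  else if form M (refl M j v) (simple i) = 0 then
    q * G j (refl M j v) + (1 - q) * G i (refl M j v)
  else G i (refl M j v) + q * G j (refl M j v)

section ruleVal

variable {q : R} {G : I → (I → ℝ) → R} {i j k l : I} {v : I → ℝ}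

theorem ruleVal_two (h : M i j = 2) : ruleVal M q G i j v = G i (refl M j v) := by
  rw [ruleVal, if_pos h]

theorem ruleVal_pos (h : M i j = 3) (hv : 0 < form M (refl M j v) (simple i)) :
    ruleVal M q G i j v = q * G j (refl M i (refl M j v)) := by
  rw [ruleVal, if_neg (by omega), if_pos hv]

theorem ruleVal_zero (h : M i j = 3) (hv : form M (refl M j v) (simple i) = 0) :
    ruleVal M q G i j v = q * G j (refl M j v) + (1 - q) * G i (refl M j v) := by
  rw [ruleVal, if_neg (by omega), if_neg hv.not_gt, if_pos hv]

theorem ruleVal_neg (h : M i j = 3) (hv : form M (refl M j v) (simple i) < 0) :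
    ruleVal M q G i j v = G i (refl M j v) + q * G j (refl M j v) := by
  rw [ruleVal, if_neg (by omega), if_neg hv.not_gt, if_neg hv.ne]

theorem ruleVal_permE (g : aut M) :
    ruleVal M q (fun i v => G ((g : Equiv.Perm I) i) (permE (g : Equiv.Perm I) v)) i j v =
      ruleVal M q G ((g : Equiv.Perm I) i) ((g : Equiv.Perm I) j)
        (permE (g : Equiv.Perm I) v) := by
  have h : M ((g : Equiv.Perm I) i) ((g : Equiv.Perm I) j) = M i j := g.2 i j
  have h2 : form M (refl M ((g : Equiv.Perm I) j) (permE (g : Equiv.Perm I) v))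
      (simple ((g : Equiv.Perm I) i)) = form M (refl M j v) (simple i) := by
    rw [← permE_refl, ← permE_simple, form_permE]
  simp only [ruleVal, permE_refl, h, h2]

/-- On the set `D` of roots, which is stable under the descents other than `s_l`, the normalised
recursion holds for every simple reflection other than `s_l`. -/
structure LocalRules (M : CoxeterMatrix I) (q : R) (G : I → (I → ℝ) → R) (l : I)
    (D : (I → ℝ) → Prop) : Prop where
  desc : ∀ {b β}, b ≠ l → D β → 0 < form M β (simple b) → D (refl M b β)
  rule : ∀ {a b β}, b ≠ l → D β → 0 < form M β (simple b) → form M β (simple a) ≤ 0 →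
    G a β = ruleVal M q G a b β

namespace LocalRules

variable {D : (I → ℝ) → Prop}

theorem two (h : LocalRules M q G l D) {a b : I} {β : I → ℝ} (hab : M a b = 2) (hb : b ≠ l)
    (hβ : D β) (h1 : 0 < form M β (simple b)) (h2 : form M β (simple a) ≤ 0) :
    G a β = G a (refl M b β) := by
  rw [h.rule hb hβ h1 h2, ruleVal_two hab]

theorem pos (h : LocalRules M q G l D) {a b : I} {β : I → ℝ} (hab : M a b = 3) (hb : b ≠ l)
    (hβ : D β) (h1 : 0 < form M β (simple b)) (h2 : form M β (simple a) ≤ 0)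
    (h3 : 0 < form M (refl M b β) (simple a)) :
    G a β = q * G b (refl M a (refl M b β)) := by
  rw [h.rule hb hβ h1 h2, ruleVal_pos hab h3]

theorem zero (h : LocalRules M q G l D) {a b : I} {β : I → ℝ} (hab : M a b = 3) (hb : b ≠ l)
    (hβ : D β) (h1 : 0 < form M β (simple b)) (h2 : form M β (simple a) ≤ 0)
    (h3 : form M (refl M b β) (simple a) = 0) :
    G a β = q * G b (refl M b β) + (1 - q) * G a (refl M b β) := by
  rw [h.rule hb hβ h1 h2, ruleVal_zero hab h3]

theorem neg (h : LocalRules M q G l D) {a b : I} {β : I → ℝ} (hab : M a b = 3) (hb : b ≠ l)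
    (hβ : D β) (h1 : 0 < form M β (simple b)) (h2 : form M β (simple a) ≤ 0)
    (h3 : form M (refl M b β) (simple a) < 0) :
    G a β = G a (refl M b β) + q * G b (refl M b β) := by
  rw [h.rule hb hβ h1 h2, ruleVal_neg hab h3]

/-- Confluence when `i`, `j`, `k` are pairwise not joined. -/
theorem confluence_two_two_two (h : LocalRules M q G l D) (hj : j ≠ l) (hk : k ≠ l)
    (hij : M i j = 2) (hik : M i k = 2) (hjk : M j k = 2)
    (dj : D (refl M j v)) (dk : D (refl M k v)) (vi : form M v (simple i) ≤ 0)
    (vj : 0 < form M v (simple j)) (vk : 0 < form M v (simple k)) :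
    ruleVal M q G i j v = ruleVal M q G i k v := by
  have hji : M j i = 2 := by rw [M.symmetric, hij]
  have hki : M k i = 2 := by rw [M.symmetric, hik]
  have hkj : M k j = 2 := by rw [M.symmetric, hjk]
  -- As in the other confluence lemmas, `F` reduces every pairing along words in s_i, s_j, s_k to
  -- linear combinations of the three pairings of v, whose signs select the clauses of the
  -- recursion.
  have F : ∀ β, form M (refl M j β) (simple i) = form M β (simple i) ∧
      form M (refl M k β) (simple i) = form M β (simple i) ∧
      form M (refl M j β) (simple k) = form M β (simple k) ∧
      form M (refl M k β) (simple j) = form M β (simple j) := by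
    intro β
    simp only [form_refl, gram_of_two hji, gram_of_two hki, gram_of_two hjk, gram_of_two hkj]
    simp
  rw [ruleVal_two hij, ruleVal_two hik,
    h.two hik hk dj (by simp only [F]; linarith) (by simp only [F]; linarith),
    h.two hij hj dk (by simp only [F]; linarith) (by simp only [F]; linarith), refl_comm hjk]

/-- Confluence when only `i` and `j` are joined. -/
theorem confluence_three_two_two (h : LocalRules M q G l D) (hj : j ≠ l) (hk : k ≠ l)
    (hi : i ≠ l) (hij : M i j = 3) (hik : M i k = 2) (hjk : M j k = 2)
    (dj : D (refl M j v)) (dk : D (refl M k v)) (vi : form M v (simple i) ≤ 0)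
    (vj : 0 < form M v (simple j)) (vk : 0 < form M v (simple k)) :
    ruleVal M q G i j v = ruleVal M q G i k v := by
  have hji : M j i = 3 := by rw [M.symmetric, hij]
  have hki : M k i = 2 := by rw [M.symmetric, hik]
  have hkj : M k j = 2 := by rw [M.symmetric, hjk]
  have F : ∀ β, form M (refl M i β) (simple j) = form M β (simple j) + form M β (simple i) ∧
      form M (refl M i β) (simple k) = form M β (simple k) ∧
      form M (refl M j β) (simple i) = form M β (simple i) + form M β (simple j) ∧
      form M (refl M j β) (simple j) = -form M β (simple j) ∧
      form M (refl M j β) (simple k) = form M β (simple k) ∧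
      form M (refl M k β) (simple i) = form M β (simple i) ∧
      form M (refl M k β) (simple j) = form M β (simple j) := by
    intro β
    simp only [form_refl, gram_of_three hij, gram_of_three hji, gram_of_two hik, gram_of_two hki,
      gram_of_two hjk, gram_of_two hkj, gram_self]
    refine ⟨?_, ?_, ?_, ?_, ?_, ?_, ?_⟩ <;> ring
  rw [ruleVal_two hik]
  rcases lt_trichotomy 0 (form M v (simple i) + form M v (simple j)) with s | s | s
  · rw [ruleVal_pos hij (by simp only [F]; linarith),
      h.pos hij hj dk (by simp only [F]; linarith) (by simp only [F]; linarith)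
        (by simp only [F]; linarith),
      h.two hjk hk (h.desc hi dj (by simp only [F]; linarith)) (by simp only [F]; linarith)
        (by simp only [F]; linarith), refl_comm hki, refl_comm hkj]
  · rw [ruleVal_zero hij (by simp only [F]; linarith),
      h.zero hij hj dk (by simp only [F]; linarith) (by simp only [F]; linarith)
        (by simp only [F]; linarith),
      h.two hjk hk dj (by simp only [F]; linarith) (by simp only [F]; linarith),
      h.two hik hk dj (by simp only [F]; linarith) (by simp only [F]; linarith), refl_comm hkj]
  · rw [ruleVal_neg hij (by simp only [F]; linarith),
      h.neg hij hj dk (by simp only [F]; linarith) (by simp only [F]; linarith)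
        (by simp only [F]; linarith),
      h.two hjk hk dj (by simp only [F]; linarith) (by simp only [F]; linarith),
      h.two hik hk dj (by simp only [F]; linarith) (by simp only [F]; linarith), refl_comm hkj]

/-- Confluence when `i` is joined to both `j` and `k`, which are not joined. -/
theorem confluence_three_three_two (h : LocalRules M q G l D) (hi : i ≠ l) (hj : j ≠ l)
    (hk : k ≠ l) (hij : M i j = 3) (hik : M i k = 3) (hjk : M j k = 2)
    (dj : D (refl M j v)) (dk : D (refl M k v)) (vi : form M v (simple i) ≤ 0)
    (vj : 0 < form M v (simple j)) (vk : 0 < form M v (simple k))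
    (hle : form M v (simple k) ≤ form M v (simple j)) :
    ruleVal M q G i j v = ruleVal M q G i k v := by
  have hji : M j i = 3 := by rw [M.symmetric, hij]
  have hki : M k i = 3 := by rw [M.symmetric, hik]
  have hkj : M k j = 2 := by rw [M.symmetric, hjk]
  have F : ∀ β, form M (refl M i β) (simple i) = -form M β (simple i) ∧
      form M (refl M i β) (simple j) = form M β (simple j) + form M β (simple i) ∧
      form M (refl M i β) (simple k) = form M β (simple k) + form M β (simple i) ∧
      form M (refl M j β) (simple i) = form M β (simple i) + form M β (simple j) ∧
      form M (refl M j β) (simple j) = -form M β (simple j) ∧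
      form M (refl M j β) (simple k) = form M β (simple k) ∧
      form M (refl M k β) (simple i) = form M β (simple i) + form M β (simple k) ∧
      form M (refl M k β) (simple j) = form M β (simple j) ∧
      form M (refl M k β) (simple k) = -form M β (simple k) := by
    intro β
    simp only [form_refl, gram_of_three hij, gram_of_three hji, gram_of_three hik,
      gram_of_three hki, gram_of_two hjk, gram_of_two hkj, gram_self]
    refine ⟨?_, ?_, ?_, ?_, ?_, ?_, ?_, ?_, ?_⟩ <;> ring
  have djk : D (refl M k (refl M j v)) := h.desc hk dj (by simp only [F]; linarith)
  have hc : refl M j (refl M k v) = refl M k (refl M j v) := refl_comm hjk v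
  have ej : G j (refl M j v) = G j (refl M k (refl M j v)) :=
    h.two hjk hk dj (by simp only [F]; linarith) (by simp only [F]; linarith)
  have ek : G k (refl M k v) = G k (refl M k (refl M j v)) := by
    rw [← hc]
    exact h.two hkj hj dk (by simp only [F]; linarith) (by simp only [F]; linarith)
  rcases lt_trichotomy 0 (form M v (simple i) + form M v (simple j)) with s | s | s
  · have dij : D (refl M i (refl M j v)) := h.desc hi dj (by simp only [F]; linarith)
    have dkij : D (refl M k (refl M i (refl M j v))) :=
      h.desc hk dij (by simp only [F]; linarith)
    have e1 : G j (refl M i (refl M j v)) = G j (refl M k (refl M i (refl M j v))) :=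
      h.two hjk hk dij (by simp only [F]; linarith) (by simp only [F]; linarith)
    -- The two sides reach common roots of lower depth by different words; braid and commutation
    -- relations identify these roots.
    have hw : refl M i (refl M k (refl M i (refl M j v))) =
        refl M k (refl M i (refl M k (refl M j v))) := refl_braid hik _
    rw [ruleVal_pos hij (by simp only [F]; linarith), e1]
    rcases lt_trichotomy 0 (form M v (simple i) + form M v (simple k)) with t | t | t
    · have dik : D (refl M i (refl M k v)) := h.desc hi dk (by simp only [F]; linarith)
      have djik : D (refl M j (refl M i (refl M k v))) :=
        h.desc hj dik (by simp only [F]; linarith)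
      rw [ruleVal_pos hik (by simp only [F]; linarith),
        h.two hkj hj dik (by simp only [F]; linarith) (by simp only [F]; linarith),
        h.pos hji hi dkij (by simp only [F]; linarith) (by simp only [F]; linarith)
          (by simp only [F]; linarith), hw,
        h.pos hki hi djik (by simp only [F]; linarith) (by simp only [F]; linarith)
          (by simp only [F]; linarith), refl_braid hij, hc, refl_comm hjk]
    · have dijk : D (refl M i (refl M k (refl M j v))) :=
        h.desc hi djk (by simp only [F]; linarith)
      have e2 : G i (refl M k v) = q * G j (refl M i (refl M k (refl M j v))) := by
        rw [← hc]
        exact h.pos hij hj dk (by simp only [F]; linarith) (by simp only [F]; linarith)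
          (by simp only [F]; linarith)
      rw [ruleVal_zero hik (by simp only [F]; linarith), ek, e2,
        h.zero hji hi dkij (by simp only [F]; linarith) (by simp only [F]; linarith)
          (by simp only [F]; linarith), hw,
        h.pos hki hi djk (by simp only [F]; linarith) (by simp only [F]; linarith)
          (by simp only [F]; linarith),
        h.two hjk hk dijk (by simp only [F]; linarith) (by simp only [F]; linarith)]
      ring
    · have dijk : D (refl M i (refl M k (refl M j v))) :=
        h.desc hi djk (by simp only [F]; linarith)
      have e2 : G i (refl M k v) = q * G j (refl M i (refl M k (refl M j v))) := by
        rw [← hc]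
        exact h.pos hij hj dk (by simp only [F]; linarith) (by simp only [F]; linarith)
          (by simp only [F]; linarith)
      rw [ruleVal_neg hik (by simp only [F]; linarith), ek, e2,
        h.neg hji hi dkij (by simp only [F]; linarith) (by simp only [F]; linarith)
          (by simp only [F]; linarith), hw,
        h.pos hki hi djk (by simp only [F]; linarith) (by simp only [F]; linarith)
          (by simp only [F]; linarith),
        h.two hjk hk dijk (by simp only [F]; linarith) (by simp only [F]; linarith)]
      ring
  · have e3 : G i (refl M j v) = q * G k (refl M i (refl M k (refl M j v))) :=
      h.pos hik hk dj (by simp only [F]; linarith) (by simp only [F]; linarith)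
        (by simp only [F]; linarith)
    rw [ruleVal_zero hij (by simp only [F]; linarith), ej, e3]
    -- Since (s_j v|α_i) = 0, the hypothesis `hle` leaves only a nonpositive value for (s_k v|α_i).
    rcases hle.lt_or_eq with t | t
    · have e2 : G i (refl M k v) = q * G j (refl M i (refl M k (refl M j v))) := by
        rw [← hc]
        exact h.pos hij hj dk (by simp only [F]; linarith) (by simp only [F]; linarith)
          (by simp only [F]; linarith)
      rw [ruleVal_neg hik (by simp only [F]; linarith), ek, e2,
        h.neg hji hi djk (by simp only [F]; linarith) (by simp only [F]; linarith)
          (by simp only [F]; linarith),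
        h.zero hki hi djk (by simp only [F]; linarith) (by simp only [F]; linarith)
          (by simp only [F]; linarith)]
      ring
    · have e2 : G i (refl M k v) = q * G j (refl M i (refl M k (refl M j v))) := by
        rw [← hc]
        exact h.pos hij hj dk (by simp only [F]; linarith) (by simp only [F]; linarith)
          (by simp only [F]; linarith)
      rw [ruleVal_zero hik (by simp only [F]; linarith), ek, e2,
        h.zero hji hi djk (by simp only [F]; linarith) (by simp only [F]; linarith)
          (by simp only [F]; linarith),
        h.zero hki hi djk (by simp only [F]; linarith) (by simp only [F]; linarith)
          (by simp only [F]; linarith)]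
      ring
  · rw [ruleVal_neg hij (by simp only [F]; linarith), ej,
      ruleVal_neg hik (by simp only [F]; linarith), ek]
    rcases lt_trichotomy 0 (form M v (simple i) + form M v (simple j) + form M v (simple k))
      with t | t | t
    · rw [h.pos hik hk dj (by simp only [F]; linarith) (by simp only [F]; linarith)
          (by simp only [F]; linarith),
        h.pos hij hj dk (by simp only [F]; linarith) (by simp only [F]; linarith)
          (by simp only [F]; linarith), hc,
        h.neg hji hi djk (by simp only [F]; linarith) (by simp only [F]; linarith)
          (by simp only [F]; linarith),
        h.neg hki hi djk (by simp only [F]; linarith) (by simp only [F]; linarith)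
          (by simp only [F]; linarith)]
      ring
    · rw [h.zero hik hk dj (by simp only [F]; linarith) (by simp only [F]; linarith)
          (by simp only [F]; linarith),
        h.zero hij hj dk (by simp only [F]; linarith) (by simp only [F]; linarith)
          (by simp only [F]; linarith), hc]
      ring
    · rw [h.neg hik hk dj (by simp only [F]; linarith) (by simp only [F]; linarith)
          (by simp only [F]; linarith),
        h.neg hij hj dk (by simp only [F]; linarith) (by simp only [F]; linarith)
          (by simp only [F]; linarith), hc]
      ring

/-- Confluence when only `j` and `k` are joined. -/
theorem confluence_two_two_three (h : LocalRules M q G l D) (hj : j ≠ l) (hk : k ≠ l)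
    (hij : M i j = 2) (hik : M i k = 2) (hjk : M j k = 3)
    (dj : D (refl M j v)) (dk : D (refl M k v)) (vi : form M v (simple i) ≤ 0)
    (vj : 0 < form M v (simple j)) (vk : 0 < form M v (simple k)) :
    ruleVal M q G i j v = ruleVal M q G i k v := by
  have hji : M j i = 2 := by rw [M.symmetric, hij]
  have hki : M k i = 2 := by rw [M.symmetric, hik]
  have hkj : M k j = 3 := by rw [M.symmetric, hjk]
  have F : ∀ β, form M (refl M j β) (simple i) = form M β (simple i) ∧
      form M (refl M k β) (simple i) = form M β (simple i) ∧
      form M (refl M j β) (simple k) = form M β (simple k) + form M β (simple j) ∧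
      form M (refl M k β) (simple j) = form M β (simple j) + form M β (simple k) ∧
      form M (refl M j β) (simple j) = -form M β (simple j) ∧
      form M (refl M k β) (simple k) = -form M β (simple k) := by
    intro β
    simp only [form_refl, gram_of_two hji, gram_of_two hki, gram_of_three hjk, gram_of_three hkj,
      gram_self]
    refine ⟨?_, ?_, ?_, ?_, ?_, ?_⟩ <;> ring
  have dkj := h.desc hk dj (by simp only [F]; linarith)
  have djk := h.desc hj dk (by simp only [F]; linarith)
  rw [ruleVal_two hij, ruleVal_two hik,
    h.two hik hk dj (by simp only [F]; linarith) (by simp only [F]; linarith),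
    h.two hij hj dkj (by simp only [F]; linarith) (by simp only [F]; linarith),
    h.two hij hj dk (by simp only [F]; linarith) (by simp only [F]; linarith),
    h.two hik hk djk (by simp only [F]; linarith) (by simp only [F]; linarith), refl_braid hjk]

/-- Confluence when `j` is joined to both `i` and `k`, which are not joined. -/
theorem confluence_three_two_three (h : LocalRules M q G l D) (hi : i ≠ l) (hj : j ≠ l)
    (hk : k ≠ l) (hij : M i j = 3) (hik : M i k = 2) (hjk : M j k = 3)
    (dj : D (refl M j v)) (dk : D (refl M k v)) (vi : form M v (simple i) ≤ 0)
    (vj : 0 < form M v (simple j)) (vk : 0 < form M v (simple k)) :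
    ruleVal M q G i j v = ruleVal M q G i k v := by
  have hji : M j i = 3 := by rw [M.symmetric, hij]
  have hki : M k i = 2 := by rw [M.symmetric, hik]
  have hkj : M k j = 3 := by rw [M.symmetric, hjk]
  have F : ∀ β, form M (refl M i β) (simple i) = -form M β (simple i) ∧
      form M (refl M i β) (simple j) = form M β (simple j) + form M β (simple i) ∧
      form M (refl M i β) (simple k) = form M β (simple k) ∧
      form M (refl M j β) (simple i) = form M β (simple i) + form M β (simple j) ∧
      form M (refl M j β) (simple j) = -form M β (simple j) ∧
      form M (refl M j β) (simple k) = form M β (simple k) + form M β (simple j) ∧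
      form M (refl M k β) (simple i) = form M β (simple i) ∧
      form M (refl M k β) (simple j) = form M β (simple j) + form M β (simple k) ∧
      form M (refl M k β) (simple k) = -form M β (simple k) := by
    intro β
    simp only [form_refl, gram_of_three hij, gram_of_three hji, gram_of_two hik,
      gram_of_two hki, gram_of_three hjk, gram_of_three hkj, gram_self]
    refine ⟨?_, ?_, ?_, ?_, ?_, ?_, ?_, ?_, ?_⟩ <;> ring
  have dkj : D (refl M k (refl M j v)) := h.desc hk dj (by simp only [F]; linarith)
  have djk : D (refl M j (refl M k v)) := h.desc hj dk (by simp only [F]; linarith)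
  have hω : refl M j (refl M k (refl M j v)) = refl M k (refl M j (refl M k v)) := refl_braid hjk v
  have dω : D (refl M k (refl M j (refl M k v))) := h.desc hk djk (by simp only [F]; linarith)
  have e0 : ruleVal M q G i k v = G i (refl M k v) := ruleVal_two hik
  have ejk : G j (refl M j v) = q * G k (refl M k (refl M j (refl M k v))) := by
    rw [← hω]
    exact h.pos hjk hk dj (by simp only [F]; linarith) (by simp only [F]; linarith)
      (by simp only [F]; linarith)
  rw [e0]
  rcases lt_trichotomy 0 (form M v (simple i) + form M v (simple j)) with s | s | s
  · have dij : D (refl M i (refl M j v)) := h.desc hi dj (by simp only [F]; linarith)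
    have dkij : D (refl M k (refl M i (refl M j v))) :=
      h.desc hk dij (by simp only [F]; linarith)
    have djkij : D (refl M j (refl M k (refl M i (refl M j v)))) :=
      h.desc hj dkij (by simp only [F]; linarith)
    have dijk : D (refl M i (refl M j (refl M k v))) := h.desc hi djk (by simp only [F]; linarith)
    -- The words s_i s_j s_k s_i s_j and s_j s_k s_i s_j s_k are equal in the parabolic subgroup of
    -- type A₃.
    have hw : refl M i (refl M j (refl M k (refl M i (refl M j v)))) =
        refl M j (refl M k (refl M i (refl M j (refl M k v)))) := by
      rw [refl_comm hki, refl_braid hij, hω, refl_comm hik]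
    rw [ruleVal_pos hij (by simp only [F]; linarith),
      h.pos hjk hk dij (by simp only [F]; linarith) (by simp only [F]; linarith)
        (by simp only [F]; linarith),
      h.pos hij hj dk (by simp only [F]; linarith) (by simp only [F]; linarith)
        (by simp only [F]; linarith),
      h.pos hjk hk dijk (by simp only [F]; linarith) (by simp only [F]; linarith)
        (by simp only [F]; linarith),
      h.two hki hi djkij (by simp only [F]; linarith) (by simp only [F]; linarith), hw]
  · have dijk : D (refl M i (refl M j (refl M k v))) := h.desc hi djk (by simp only [F]; linarith)
    have hw : refl M k (refl M i (refl M j (refl M k v))) =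
      refl M i (refl M k (refl M j (refl M k v))) := refl_comm hki _
    rw [ruleVal_zero hij (by simp only [F]; linarith), ejk,
      h.two hki hi dω (by simp only [F]; linarith) (by simp only [F]; linarith),
      h.two hik hk dj (by simp only [F]; linarith) (by simp only [F]; linarith),
      h.pos hij hj dkj (by simp only [F]; linarith) (by simp only [F]; linarith)
        (by simp only [F]; linarith), hω,
      h.pos hij hj dk (by simp only [F]; linarith) (by simp only [F]; linarith)
        (by simp only [F]; linarith),
      h.zero hjk hk dijk (by simp only [F]; linarith) (by simp only [F]; linarith)
        (by simp only [F]; linarith), hw]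
    ring
  · rw [ruleVal_neg hij (by simp only [F]; linarith), ejk,
      h.two hik hk dj (by simp only [F]; linarith) (by simp only [F]; linarith)]
    rcases lt_trichotomy 0 (form M v (simple i) + form M v (simple j) + form M v (simple k))
      with t | t | t
    · have dijk : D (refl M i (refl M j (refl M k v))) :=
        h.desc hi djk (by simp only [F]; linarith)
      have hw : refl M k (refl M i (refl M j (refl M k v))) =
        refl M i (refl M k (refl M j (refl M k v))) := refl_comm hki _
      rw [h.pos hij hj dkj (by simp only [F]; linarith) (by simp only [F]; linarith)
          (by simp only [F]; linarith), hω,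
        h.two hki hi dω (by simp only [F]; linarith) (by simp only [F]; linarith),
        h.pos hij hj dk (by simp only [F]; linarith) (by simp only [F]; linarith)
          (by simp only [F]; linarith),
        h.neg hjk hk dijk (by simp only [F]; linarith) (by simp only [F]; linarith)
          (by simp only [F]; linarith), hw]
      ring
    · rw [h.zero hij hj dkj (by simp only [F]; linarith) (by simp only [F]; linarith)
          (by simp only [F]; linarith), hω,
        h.zero hij hj dk (by simp only [F]; linarith) (by simp only [F]; linarith)
          (by simp only [F]; linarith),
        h.two hik hk djk (by simp only [F]; linarith) (by simp only [F]; linarith),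
        h.neg hjk hk djk (by simp only [F]; linarith) (by simp only [F]; linarith)
          (by simp only [F]; linarith)]
      ring
    · rw [h.neg hij hj dkj (by simp only [F]; linarith) (by simp only [F]; linarith)
          (by simp only [F]; linarith), hω,
        h.neg hij hj dk (by simp only [F]; linarith) (by simp only [F]; linarith)
          (by simp only [F]; linarith),
        h.two hik hk djk (by simp only [F]; linarith) (by simp only [F]; linarith),
        h.neg hjk hk djk (by simp only [F]; linarith) (by simp only [F]; linarith)
          (by simp only [F]; linarith)]
      ring

theorem confluence (hM : IsSmall M) (hT : NoTriangle M) (h : LocalRules M q G l D)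
    (hi : i ≠ l) (hj : j ≠ l) (hk : k ≠ l) (hjk : j ≠ k)
    (dj : D (refl M j v)) (dk : D (refl M k v)) (vi : form M v (simple i) ≤ 0)
    (vj : 0 < form M v (simple j)) (vk : 0 < form M v (simple k)) :
    ruleVal M q G i j v = ruleVal M q G i k v := by
  have hij : i ≠ j := by rintro rfl; linarith
  have hik : i ≠ k := by rintro rfl; linarith
  rcases (hM.cases j k).resolve_left hjk with jk | jk <;>
    rcases (hM.cases i j).resolve_left hij with ij | ij <;>
    rcases (hM.cases i k).resolve_left hik with ik | ik
  · exact h.confluence_two_two_two hj hk ij ik jk dj dk vi vj vk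
  · exact (h.confluence_three_two_two hk hj hi ik ij (by rw [M.symmetric, jk])
      dk dj vi vk vj).symm
  · exact h.confluence_three_two_two hj hk hi ij ik jk dj dk vi vj vk
  -- The roles of j and k are symmetric here, so their pairings with v may be ordered.
  · rcases le_total (form M v (simple k)) (form M v (simple j)) with hle | hle
    · exact h.confluence_three_three_two hi hj hk ij ik jk dj dk vi vj vk hle
    · exact (h.confluence_three_three_two hi hk hj ik ij (by rw [M.symmetric, jk])
        dk dj vi vk vj hle).symm
  · exact h.confluence_two_two_three hj hk ij ik jk dj dk vi vj vk
  · exact (h.confluence_three_two_three hi hk hj ik ij (by rw [M.symmetric, jk])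
      dk dj vi vk vj).symm
  · exact h.confluence_three_two_three hi hj hk ij ik jk dj dk vi vj vk
  · exact absurd ⟨i, j, k, ij, jk, by rw [M.symmetric, ik]⟩ hT

end LocalRules

end ruleVal

/-! ### Uniqueness and independence of the choice for the normalised recursion. -/

/-- Otherwise v = s_j(α_i), and each possible value of m_{i,j} contradicts one of the two signs. It
guarantees that a second descent by s_i from s_j v is legitimate. -/
theorem IsSmall.refl_ne_simple (hM : IsSmall M) {v : I → ℝ} {i j : I}
    (hi : form M v (simple i) ≤ 0) (hj : 0 < form M v (simple j)) : refl M j v ≠ simple i := by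
  intro h
  rw [← refl_refl M j v, h, form_refl, form_simple, form_simple, gram_self] at hi
  have h5 := form_refl_self M j v
  rw [h, form_simple] at h5
  rcases hM.gram_cases i j with h6 | h6 | h6
  · linarith [h6.2]
  · linarith [h6.2.2]
  · rw [gram_symm M j i, h6.2.2] at hi
    linarith

/-- `(v | α_{j v}) > 0` for every non-simple positive root `v`. -/
def DescentChoice (M : CoxeterMatrix I) (j : (I → ℝ) → I) : Prop :=
  ∀ n v, Lev M n v → (∀ k, v ≠ simple k) → 0 < form M v (simple (j v))

/-- The normalised recursion of Paris, with initial values `y` and `z`. -/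
structure ParisSystem (M : CoxeterMatrix I) (q y z : R) (G : I → (I → ℝ) → R)
    (j : (I → ℝ) → I) : Prop where
  base_self : ∀ i, G i (simple i) = y
  base_ne : ∀ i k, i ≠ k → G i (simple k) = z
  pos : ∀ i n v, Lev M n v → (∀ k, v ≠ simple k) → 0 < form M v (simple i) → G i v = 0
  rule : ∀ i n v, Lev M n v → (∀ k, v ≠ simple k) → form M v (simple i) ≤ 0 →
    G i v = ruleVal M q G i (j v) v

namespace ParisSystem

variable {q y z : R} {G G' : I → (I → ℝ) → R} {j j' : (I → ℝ) → I}

theorem unique (hM : IsSmall M) (hj : DescentChoice M j) (h : ParisSystem M q y z G j)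
    (h' : ParisSystem M q y z G' j) {n : ℕ} {v : I → ℝ} (hv : Lev M n v) (i : I) :
    G i v = G' i v := by
  induction n using Nat.strong_induction_on generalizing v i with
  | _ n ih =>
  by_cases hs : ∃ k, v = simple k
  · obtain ⟨k, rfl⟩ := hs
    by_cases hik : i = k
    · rw [hik, h.base_self, h'.base_self]
    · rw [h.base_ne i k hik, h'.base_ne i k hik]
  push Not at hs
  by_cases hi : 0 < form M v (simple i)
  · rw [h.pos i n v hv hs hi, h'.pos i n v hv hs hi]
  push Not at hi
  have hjv := hj n v hv hs
  obtain ⟨m, rfl, hm⟩ := hv.descent hM (hs _) hjv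
  have ih1 := fun i => ih m (by omega) hm i
  rw [h.rule i _ v hv hs hi, h'.rule i _ v hv hs hi]
  simp only [ruleVal, ih1]
  split_ifs with h1 h2 h3
  · rfl
  · obtain ⟨m', rfl, hm'⟩ := hm.descent hM (hM.refl_ne_simple hi hjv) h2
    rw [ih m' (by omega) hm' _]
  · rfl
  · rfl

/-- The recursion is written in terms of Γ alone apart from the choice j, which transport by g
conjugates. -/
theorem permE (h : ParisSystem M q y z G j) (g : aut M) :
    ParisSystem M q y z
      (fun i v => G ((g : Equiv.Perm I) i) (LK.permE (g : Equiv.Perm I) v))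
      (fun v => (g : Equiv.Perm I).symm (j (LK.permE (g : Equiv.Perm I) v))) := by
  have hs : ∀ v : I → ℝ, (∀ k, v ≠ simple k) →
      ∀ k, LK.permE (g : Equiv.Perm I) v ≠ simple k := by
    intro v hv k hk
    refine hv ((g : Equiv.Perm I).symm k) ((LK.permE (g : Equiv.Perm I)).injective ?_)
    rw [hk, permE_simple, Equiv.apply_symm_apply]
  refine ⟨fun i => ?_, fun i k hik => ?_, fun i n v hv hv' hi => ?_, fun i n v hv hv' hi => ?_⟩
  · rw [permE_simple, h.base_self]
  · rw [permE_simple, h.base_ne _ _ (g.1.injective.ne hik)]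
  · exact h.pos _ n _ (hv.permE g) (hs v hv') (by rwa [← permE_simple, form_permE])
  · rw [ruleVal_permE, Equiv.apply_symm_apply]
    exact h.rule _ n _ (hv.permE g) (hs v hv') (by rwa [← permE_simple, form_permE])

end ParisSystem

theorem DescentChoice.permE {j : (I → ℝ) → I} (h : DescentChoice M j) (g : aut M) :
    DescentChoice M
      (fun v => (g : Equiv.Perm I).symm (j (LK.permE (g : Equiv.Perm I) v))) := by
  intro n v hv hv'
  have h1 := h n _ (hv.permE g) (fun k hk => hv' ((g : Equiv.Perm I).symm k)
    ((LK.permE (g : Equiv.Perm I)).injective (by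
      rw [hk, permE_simple, Equiv.apply_symm_apply])))
  have h2 : form M v (simple ((g : Equiv.Perm I).symm (j (LK.permE (g : Equiv.Perm I) v)))) =
      form M (LK.permE (g : Equiv.Perm I) v) (simple (j (LK.permE (g : Equiv.Perm I) v))) := by
    rw [← form_permE M g, permE_simple, Equiv.apply_symm_apply]
  rwa [h2]

/-- A positive root supported on `{i, j, k}`, with `(v | α_i) ≤ 0`, `(v | α_j) > 0` and
`(v | α_k) > 0`. -/
theorem Lev.eq_of_support (hM : IsSmall M) (hT : NoTriangle M) {n : ℕ} {v : I → ℝ}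
    (hv : Lev M n v) {i j k : I} (hij : i ≠ j) (hik : i ≠ k) (hjk : j ≠ k)
    (hsupp : ∀ l, l ≠ i → l ≠ j → l ≠ k → v l = 0)
    (vi : form M v (LK.simple i) ≤ 0) (vj : 0 < form M v (LK.simple j))
    (vk : 0 < form M v (LK.simple k)) :
    M j k = 3 ∧ v = LK.simple j + LK.simple k ∨
      M j k = 2 ∧ M i j = 3 ∧ M i k = 3 ∧ v = LK.simple i + LK.simple j + LK.simple k := by
  obtain ⟨A, hA⟩ := hv.coord_int hM i
  obtain ⟨B, hB⟩ := hv.coord_int hM j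
  obtain ⟨C, hC⟩ := hv.coord_int hM k
  have hA0 : 0 ≤ A := by have := hv.nonneg i; rw [hA] at this; exact_mod_cast this
  have hB0 : 0 ≤ B := by have := hv.nonneg j; rw [hB] at this; exact_mod_cast this
  have hC0 : 0 ≤ C := by have := hv.nonneg k; rw [hC] at this; exact_mod_cast this
  have hdec : v = (A : ℝ) • LK.simple i + (B : ℝ) • LK.simple j + (C : ℝ) • LK.simple k := by
    ext l
    by_cases li : l = i
    · subst li; simp [LK.simple, hA, hij, hik]
    by_cases lj : l = j
    · subst lj; simp [LK.simple, hB, hij.symm, hjk]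
    by_cases lk : l = k
    · subst lk; simp [LK.simple, hC, hik.symm, hjk.symm]
    · simp [LK.simple, hsupp l li lj lk, li, lj, lk]
  have hf : ∀ l, form M v (LK.simple l) = A * gram M i l + B * gram M j l + C * gram M k l := by
    intro l
    rw [hdec]
    simp [form_simple]
  have hn : (A : ℝ) * form M v (LK.simple i) + B * form M v (LK.simple j) +
      C * form M v (LK.simple k) = 2 := by
    have h0 := congrArg (form M v) hdec
    simp only [map_add, map_smul, smul_eq_mul] at h0
    rw [← h0, hv.norm]
  rw [hf, hf, hf, gram_self, gram_self, gram_self, gram_symm M j i, gram_symm M k i,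
    gram_symm M k j] at hn
  rw [hf, gram_self, gram_symm M j i, gram_symm M k i] at vi
  rw [hf, gram_self, gram_symm M k j] at vj
  rw [hf, gram_self] at vk
  have fin1 : A = 0 → B = 1 → C = 1 → v = LK.simple j + LK.simple k := by
    rintro rfl rfl rfl
    rw [hdec]; simp
  have fin2 : A = 1 → B = 1 → C = 1 → v = LK.simple i + LK.simple j + LK.simple k := by
    rintro rfl rfl rfl
    rw [hdec]; simp
  -- Here v = Aα_i + Bα_j + Cα_k with nonnegative integers, and `hn` is (v|v) = 2. For each rank 3
  -- diagram without triangle, this quadratic equation and the three signs are contradictory or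
  -- bound the coefficients by 1.
  rcases (hM.cases j k).resolve_left hjk with jk | jk <;>
    rcases (hM.cases i j).resolve_left hij with ij | ij <;>
    rcases (hM.cases i k).resolve_left hik with ik | ik <;>
    simp only [gram_of_two, gram_of_three, jk, ij, ik] at hn vi vj vk <;>
    ring_nf at hn vi vj vk <;> norm_cast at hn vi vj vk
  · have : 1 ≤ B := by omega
    have : 1 ≤ C := by omega
    nlinarith
  · have : 1 ≤ B := by omega
    have : 1 ≤ C := by omega
    nlinarith [sq_nonneg (2 * A - C)]
  · have : 1 ≤ B := by omega
    have : 1 ≤ C := by omega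
    nlinarith [sq_nonneg (2 * A - B)]
  · refine Or.inr ⟨jk, ij, ik, ?_⟩
    have hA1 : A ≤ 1 := by nlinarith
    have hB1 : B ≤ 1 := by nlinarith
    have hC1 : C ≤ 1 := by nlinarith
    apply fin2 <;> interval_cases A <;> interval_cases B <;> interval_cases C <;> omega
  · refine Or.inl ⟨jk, ?_⟩
    have hA1 : A ≤ 1 := by nlinarith
    have hB1 : B ≤ 1 := by nlinarith
    have hC1 : C ≤ 1 := by nlinarith
    apply fin1 <;> interval_cases A <;> interval_cases B <;> interval_cases C <;> omega
  · refine Or.inl ⟨jk, ?_⟩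
    have hA1 : A ≤ 1 := by nlinarith
    have hB1 : B ≤ 1 := by nlinarith
    have hC1 : C ≤ 1 := by nlinarith
    apply fin1 <;> interval_cases A <;> interval_cases B <;> interval_cases C <;> omega
  · refine Or.inl ⟨jk, ?_⟩
    have hA1 : A ≤ 1 := by nlinarith
    have hB1 : B ≤ 1 := by nlinarith
    have hC1 : C ≤ 1 := by nlinarith
    apply fin1 <;> interval_cases A <;> interval_cases B <;> interval_cases C <;> omega
  · exact absurd ⟨i, j, k, ij, jk, by rw [M.symmetric, ik]⟩ hT

/-- The value does not mention j or k, which settles confluence at this root. Without a triangle i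
is joined to at most one of j and k; if it is joined to j, the clause gives qz + (1 - q)z = z. -/
theorem ruleVal_simple_add_simple (hM : IsSmall M) (hT : NoTriangle M) {q z : R}
    {G : I → (I → ℝ) → R} (hbase : ∀ i k, i ≠ k → G i (simple k) = z) {i j k : I} (hij : i ≠ j)
    (hik : i ≠ k) (hjk : M j k = 3) : ruleVal M q G i j (simple j + simple k) = z := by
  have hkj : M k j = 3 := by rw [M.symmetric, hjk]
  have e : refl M j (simple j + simple k) = simple k := by
    rw [add_comm, ← refl_simple_of_three hkj, refl_refl]
  rcases (hM.cases i j).resolve_left hij with ij | ij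
  · rw [ruleVal_two ij, e, hbase i k hik]
  · rcases (hM.cases k i).resolve_left hik.symm with ki | ki
    · rw [ruleVal_zero ij (by rw [e, form_simple, gram_of_two ki]), e, hbase i k hik,
        hbase j k (ne_of_three hjk)]
      ring
    · exact absurd ⟨i, j, k, ij, hjk, ki⟩ hT

theorem ruleVal_simple_add_simple_add_simple {q z : R} {G : I → (I → ℝ) → R}
    (hbase : ∀ i k, i ≠ k → G i (simple k) = z) {i j k : I} (hij : M i j = 3) (hik : M i k = 3)
    (hjk : M j k = 2) : ruleVal M q G i j (simple i + simple j + simple k) = q * z := by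
  have hki : M k i = 3 := by rw [M.symmetric, hik]
  have hkj : M k j = 2 := by rw [M.symmetric, hjk]
  have e1 : refl M j (simple i + simple j + simple k) = simple k + simple i := by
    rw [map_add, ← refl_simple_of_three hij, refl_refl,
      refl_eq_self (by rw [form_simple, gram_of_two hkj]), add_comm]
  have e2 : refl M i (simple k + simple i) = simple k := by
    rw [← refl_simple_of_three hki, refl_refl]
  have h1 : form M (simple k + simple i) (simple i) = 1 := by
    rw [map_add, LinearMap.add_apply, form_simple, form_simple, gram_of_three hki, gram_self]
    norm_num
  rw [ruleVal_pos hij (by rw [e1, h1]; norm_num), e1, e2, hbase j k (ne_of_two hjk)]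

theorem ne_simple_of_coord {v : I → ℝ} {k l : I} (hl : 0 < v l) (hk : k ≠ l) : v ≠ simple k := by
  rintro rfl
  simp [simple, hk.symm] at hl

/-- The recursion, imposed only for the chosen descent, holds for every descent. By induction on the
depth this follows from confluence in {i, j, k}; the obstacle is that the recursion is not available
at simple roots, so the roots supported on {i, j, k} are checked directly. -/
theorem ParisSystem.rule_of_pos (hM : IsSmall M) (hT : NoTriangle M) {q y z : R}
    {G : I → (I → ℝ) → R} {j : (I → ℝ) → I} (hj : DescentChoice M j)
    (h : ParisSystem M q y z G j) {n : ℕ} {v : I → ℝ} (hv : Lev M n v)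
    (hs : ∀ k, v ≠ simple k) {i k : I} (hi : form M v (simple i) ≤ 0)
    (hk : 0 < form M v (simple k)) : G i v = ruleVal M q G i k v := by
  induction n using Nat.strong_induction_on generalizing v i k with
  | _ n ih =>
  rw [h.rule i n v hv hs hi]
  have hjv := hj n v hv hs
  generalize j v = j at hjv
  by_cases hjk : j = k
  · rw [hjk]
  have hij : i ≠ j := by rintro rfl; linarith
  have hik : i ≠ k := by rintro rfl; linarith
  by_cases hl : ∀ l, l ≠ i → l ≠ j → l ≠ k → v l = 0
  · rcases hv.eq_of_support hM hT hij hik hjk hl hi hjv hk with ⟨jk, rfl⟩ | ⟨jk, ij, ik, rfl⟩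
    · rw [ruleVal_simple_add_simple hM hT h.base_ne hij hik jk, add_comm,
        ruleVal_simple_add_simple hM hT h.base_ne hik hij (by rw [M.symmetric, jk])]
    · rw [ruleVal_simple_add_simple_add_simple h.base_ne ij ik jk, add_right_comm,
        ruleVal_simple_add_simple_add_simple h.base_ne ik ij (by rw [M.symmetric, jk])]
  · push Not at hl
    obtain ⟨l, li, lj, lk, hl⟩ := hl
    have hl0 : 0 < v l := lt_of_le_of_ne (hv.nonneg l) hl.symm
    -- Reflections other than s_l leave the positive l-coordinate unchanged. So the only simple root
    -- that could be met is α_l, which pairs positively with no other simple root and therefore has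
    -- no descent to consider.
    have hloc : LocalRules M q G l fun β => (∃ m < n, Lev M m β) ∧ 0 < β l := by
      refine ⟨?_, ?_⟩
      · rintro b β hb ⟨⟨m, hm, hβ⟩, hβl⟩ hpos
        obtain ⟨m', rfl, hm'⟩ := hβ.descent hM (ne_simple_of_coord hβl hb) hpos
        exact ⟨⟨m', by omega, hm'⟩, by rwa [refl_apply_of_ne M hb.symm]⟩
      · rintro a b β hb ⟨⟨m, hm, hβ⟩, hβl⟩ hpos hneg
        refine ih m hm hβ ?_ hneg hpos
        rintro c rfl
        rw [form_simple] at hpos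
        exact ne_simple_of_coord hβl hb (congrArg simple (hM.eq_of_gram_pos hpos))
    have hD : ∀ b, b ≠ l → 0 < form M v (simple b) →
        (∃ m < n, Lev M m (refl M b v)) ∧ 0 < refl M b v l := by
      intro b hb hpos
      obtain ⟨m', rfl, hm'⟩ := hv.descent hM (hs b) hpos
      exact ⟨⟨m', by omega, hm'⟩, by rwa [refl_apply_of_ne M hb.symm]⟩
    exact hloc.confluence hM hT li.symm lj.symm lk.symm hjk (hD j lj.symm hjv)
      (hD k lk.symm hk) hi hjv hk

theorem ParisSystem.change_choice (hM : IsSmall M) (hT : NoTriangle M) {q y z : R}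
    {G : I → (I → ℝ) → R} {j j' : (I → ℝ) → I} (hj : DescentChoice M j)
    (hj' : DescentChoice M j') (h : ParisSystem M q y z G j) : ParisSystem M q y z G j' :=
  ⟨h.base_self, h.base_ne, h.pos, fun _ n v hv hs hi =>
    h.rule_of_pos hM hT hj hv hs hi (hj' n v hv hs)⟩

/-! ### Paris's family as a solution of the normalised recursion. -/

section Paris

variable {b c d : Rˣ} {x : R} {j : (I → ℝ) → I}

theorem Lev.two_le (hM : IsSmall M) {n : ℕ} {v : I → ℝ} (hv : Lev M n v)
    (hs : ∀ k, v ≠ LK.simple k) : 2 ≤ n := by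
  obtain ⟨k, hk⟩ := hv.exists_pos hs
  obtain ⟨m, rfl, hm⟩ := hv.descent hM (hs k) hk
  have := hm.pos
  omega

theorem isChoice_iff (hM : IsSmall M) : IsChoice M j ↔ DescentChoice M j := by
  constructor
  · intro h n v hv hs
    exact h v hv.mem (by rw [hv.depth_eq hM]; exact hv.two_le hM hs)
  · intro h v hv h2
    refine h _ v (lev_depth hM hv) ?_
    rintro k rfl
    rw [(Lev.simple k).depth_eq hM] at h2
    omega

/-- The recursion step of `parisAux`, with the conditions on depths replaced by signs. -/
theorem parisAux_succ (hM : IsSmall M) {n N : ℕ} {v : I → ℝ} (hv : Lev M (n + 1) v)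
    (hs : ∀ k, v ≠ simple k) (hj : 0 < form M v (simple (j v))) {i : I}
    (hi : form M v (simple i) ≤ 0) :
    parisAux M b c d x j (N + 1) i v =
      if M i (j v) = 2 then ((b / d : Rˣ) : R) * parisAux M b c d x j N i (refl M (j v) v)
      else if 0 < form M (refl M (j v) v) (simple i) then
        ((c⁻¹ : Rˣ) : R) * ((b : R) * parisAux M b c d x j N (j v) (refl M i (refl M (j v) v))
          - aParam b c d * parisAux M b c d x j N i (refl M (j v) v))
      else if form M (refl M (j v) v) (simple i) = 0 then
        ((c⁻¹ : Rˣ) : R) * ((d : R) * parisAux M b c d x j N (j v) (refl M (j v) v)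
          - aParam b c d * parisAux M b c d x j N i (refl M (j v) v))
      else
        ((b / d : Rˣ) : R) * parisAux M b c d x j N i (refl M (j v) v)
          + ((d / c : Rˣ) : R) * parisAux M b c d x j N (j v) (refl M (j v) v)
          + aParam b c d * (d : R) * x * (((c ^ 2)⁻¹ : Rˣ) : R)
            * (((b / d) ^ ((n + 1 : ℤ) - 3) : Rˣ) : R) := by
  obtain ⟨m, hm, hβ⟩ := hv.descent hM (hs _) hj
  obtain rfl : n = m := by omega
  have hβi := hM.refl_ne_simple hi hj
  have h1 : depth M (refl M i (refl M (j v) v)) < depth M (refl M (j v) v) ↔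
      0 < form M (refl M (j v) v) (simple i) := by
    rcases hβ.refl_cases hM i with h | h | h | ⟨-, h2, m, rfl, h3⟩
    · exact absurd h.1 hβi
    · simp [h.1, h.2]
    · rw [h.2.depth_eq hM, hβ.depth_eq hM]
      simp [h.1.le]
    · rw [h3.depth_eq hM, hβ.depth_eq hM]
      simp [h2]
  have h2 : refl M i (refl M (j v) v) = refl M (j v) v ↔
      form M (refl M (j v) v) (simple i) = 0 := by
    refine ⟨fun h => ?_, refl_eq_self⟩
    have := form_refl_self M i (refl M (j v) v)
    rw [h] at this
    linarith
  rw [parisAux, if_neg (hs i), if_neg (by simpa using hs), if_neg hi.not_gt, hv.depth_eq hM]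
  simp only [h1, h2, Nat.cast_add, Nat.cast_one]

/-- The first argument of `parisAux` drops by one at each call, whereas s_i s_j v may lie two levels
below v; this lets coefficients be compared at their exact depth. -/
theorem parisAux_of_le (hM : IsSmall M) (hj : DescentChoice M j) {n N : ℕ} {v : I → ℝ}
    (hv : Lev M n v) (hN : n ≤ N) (i : I) :
    parisAux M b c d x j N i v = parisAux M b c d x j n i v := by
  induction n using Nat.strong_induction_on generalizing v i N with
  | _ n ih =>
  obtain ⟨n, rfl⟩ : ∃ m, n = m + 1 := ⟨n - 1, by have := hv.pos; omega⟩
  obtain ⟨N, rfl⟩ : ∃ m, N = m + 1 := ⟨N - 1, by omega⟩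
  by_cases hs : ∃ k, v = simple k
  · simp only [parisAux, if_pos hs]
  by_cases hi : 0 < form M v (simple i)
  · simp only [parisAux, if_neg hs, if_pos hi]
  push Not at hs hi
  have hjv := hj _ v hv hs
  obtain ⟨m, hm, hβ⟩ := hv.descent hM (hs _) hjv
  obtain rfl : n = m := by omega
  have ih1 : ∀ i, parisAux M b c d x j N i (refl M (j v) v) =
      parisAux M b c d x j n i (refl M (j v) v) := fun i => ih n (by omega) hβ (by omega) i
  rw [parisAux_succ hM hv hs hjv hi, parisAux_succ hM hv hs hjv hi]
  simp only [ih1]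
  split_ifs with h1 h2
  · rfl
  · obtain ⟨m, rfl, hm'⟩ := hβ.descent hM (hM.refl_ne_simple hi hjv) h2
    rw [ih m (by omega) hm' (by omega : m ≤ N), ih m (by omega) hm' (by omega : m ≤ m + 1)]
  · rfl
  · rfl

/-- The normalised coefficients of Paris's family. -/
noncomputable def parisNorm (M : CoxeterMatrix I) (b c d : Rˣ) (x : R) (j : (I → ℝ) → I) (i : I)
    (v : I → ℝ) : R :=
  (((b / d) ^ (2 - (depth M v : ℤ)) : Rˣ) : R) * parisAux M b c d x j (depth M v) i v +
    aParam b c d * ((c⁻¹ : Rˣ) : R) * x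

theorem parisNorm_eq (hM : IsSmall M) {n : ℕ} {v : I → ℝ} (hv : Lev M n v) (i : I) :
    parisNorm M b c d x j i v = (((b / d) ^ (2 - (n : ℤ)) : Rˣ) : R) *
      parisAux M b c d x j n i v + aParam b c d * ((c⁻¹ : Rˣ) : R) * x := by
  rw [parisNorm, hv.depth_eq hM]

theorem aParam_mul_inv (b c d : Rˣ) :
    aParam b c d * ((c⁻¹ : Rˣ) : R) = ((d / c : Rˣ) : R) - ((b / d : Rˣ) : R) := by
  rw [aParam, sub_mul, ← Units.val_mul, ← Units.val_mul, ← div_eq_mul_inv,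
    mul_comm b c, mul_div_assoc, mul_comm c, mul_inv_cancel_right]

/-- With t = b/d and u = d/c one has a/c = u - t and q = u/t. The factor t^(2 - dep) cancels the
powers of t in the recursion, and the shift by ax/c absorbs the constant term and makes the
coefficients with (v|α_i) > 0 vanish. -/
theorem parisSystem_parisNorm (hM : IsSmall M) (hj : DescentChoice M j) :
    ParisSystem M (((d / c) * (b / d)⁻¹ : Rˣ) : R)
      (((b / d : Rˣ) : R) * x + aParam b c d * ((c⁻¹ : Rˣ) : R) * x)
      (aParam b c d * ((c⁻¹ : Rˣ) : R) * x) (parisNorm M b c d x j) j := by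
  have hpos : ∀ i n v, Lev M n v → (∀ k, v ≠ simple k) → 0 < form M v (simple i) →
      parisNorm M b c d x j i v = 0 := by
    intro i n v hv hs hi
    obtain ⟨m, rfl⟩ : ∃ m, n = m + 1 := ⟨n - 1, by have := hv.pos; omega⟩
    have h1 : (((b / d) ^ (2 - ((m + 1 : ℕ) : ℤ)) : Rˣ) : R) *
        (((b / d) ^ (((m + 1 : ℕ) : ℤ) - 2) : Rˣ) : R) = 1 := by
      rw [← Units.val_mul, ← zpow_add]
      simp
    rw [parisNorm_eq hM hv, parisAux, if_neg (hs i), if_neg (by simpa using hs), if_pos hi,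
      hv.depth_eq hM]
    linear_combination (-(aParam b c d * x * ((c⁻¹ : Rˣ) : R))) * h1
  refine ⟨fun i => ?_, fun i k hik => ?_, hpos, fun i n v hv hs hi => ?_⟩
  · rw [parisNorm_eq hM (Lev.simple i)]
    simp [parisAux]
  · have h1 : (simple k : I → ℝ) ≠ simple i := fun h => hik (simple_injective h).symm
    rw [parisNorm_eq hM (Lev.simple k)]
    simp [parisAux, h1]
  · have hjv := hj n v hv hs
    obtain ⟨m, rfl, hβ⟩ := hv.descent hM (hs _) hjv
    have ht : ((b / d : Rˣ) : R) * (((b / d)⁻¹ : Rˣ) : R) = 1 := by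
      rw [← Units.val_mul, mul_inv_cancel, Units.val_one]
    have hbc : (b : R) * ((c⁻¹ : Rˣ) : R) = ((b / d : Rˣ) : R) * ((d / c : Rˣ) : R) := by
      rw [← Units.val_mul, ← Units.val_mul, div_mul_div_cancel, div_eq_mul_inv]
    have hdc : (d : R) * ((c⁻¹ : Rˣ) : R) = ((d / c : Rˣ) : R) := by
      rw [← Units.val_mul, div_eq_mul_inv]
    have hac := aParam_mul_inv b c d
    have hT1 : (((b / d) ^ (2 - (m : ℤ)) : Rˣ) : R) =
        (((b / d) ^ (2 - ((m + 1 : ℕ) : ℤ)) : Rˣ) : R) * ((b / d : Rˣ) : R) := by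
      rw [← Units.val_mul, ← zpow_add_one]
      congr 2
      push_cast
      ring
    rw [parisNorm_eq hM hv, parisAux_succ hM hv hs hjv hi, ruleVal, parisNorm_eq hM hβ,
      parisNorm_eq hM hβ, hT1, hac, Units.val_mul (d / c)]
    split_ifs with h1 h2 h3
    · ring
    · obtain ⟨m, rfl, hγ⟩ := hβ.descent hM (hM.refl_ne_simple hi hjv) h2
      have hβs : ∀ k, refl M (j v) v ≠ simple k := by
        rintro k hk
        rw [hk, form_simple] at h2
        exact hM.refl_ne_simple hi hjv (hk.trans (congrArg simple (hM.eq_of_gram_pos h2)))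
      have hT2 : (((b / d) ^ (2 - (m : ℤ)) : Rˣ) : R) =
          (((b / d) ^ (2 - ((m + 1 : ℕ) : ℤ)) : Rˣ) : R) * ((b / d : Rˣ) : R) := by
        rw [← Units.val_mul, ← zpow_add_one]
        congr 2
        push_cast
        ring
      -- Since β = s_j v pairs positively with α_i, its normalised coefficient at i is zero; this
      -- eliminates f_{i,β} and leaves only the term q G_{j,γ}.
      have hz := hpos i _ _ hβ hβs h2
      rw [parisNorm_eq hM hβ, hT1, hac] at hz
      rw [parisNorm_eq hM hγ, parisAux_of_le hM hj hγ (Nat.le_succ m), hT2, hT1, hac]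
      generalize parisAux M b c d x j m (j v) (refl M i (refl M (j v) v)) = Pγ at *
      generalize parisAux M b c d x j (m + 1) i (refl M (j v) v) = Pβ at *
      generalize (((b / d) ^ (2 - ((m + 1 + 1 : ℕ) : ℤ)) : Rˣ) : R) = T at *
      generalize (((b / d)⁻¹ : Rˣ) : R) = ti at *
      generalize ((b / d : Rˣ) : R) = t at *
      generalize ((d / c : Rˣ) : R) = u at *
      linear_combination (-(u - t) * ti) * hz -
        (T * t * u * Pγ - T * (u - t) * Pβ + (u - t) * x) * ht + T * Pγ * hbc - T * Pβ * hac
    · linear_combination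
        (((b / d) ^ (2 - ((m + 1 : ℕ) : ℤ)) : Rˣ) : R) *
          (parisAux M b c d x j m (j v) (refl M (j v) v) * hdc -
            parisAux M b c d x j m i (refl M (j v) v) * hac -
            ((d / c : Rˣ) : R) * (parisAux M b c d x j m (j v) (refl M (j v) v) -
              parisAux M b c d x j m i (refl M (j v) v)) * ht)
    · have hE : (((b / d) ^ (2 - ((m + 1 : ℕ) : ℤ)) : Rˣ) : R) *
          (((b / d) ^ ((m + 1 : ℤ) - 3) : Rˣ) : R) = (((b / d)⁻¹ : Rˣ) : R) := by
        rw [← Units.val_mul, ← zpow_add, ← zpow_neg_one]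
        congr 2
        push_cast
        ring
      have hcc : (((c ^ 2)⁻¹ : Rˣ) : R) = ((c⁻¹ : Rˣ) : R) * ((c⁻¹ : Rˣ) : R) := by
        rw [← Units.val_mul, sq, mul_inv]
      rw [hcc]
      generalize parisAux M b c d x j m (j v) (refl M (j v) v) = Pj at *
      generalize parisAux M b c d x j m i (refl M (j v) v) = Pi at *
      generalize (((b / d) ^ ((m + 1 : ℤ) - 3) : Rˣ) : R) = E at *
      generalize (((b / d) ^ (2 - ((m + 1 : ℕ) : ℤ)) : Rˣ) : R) = T at *
      generalize (((b / d)⁻¹ : Rˣ) : R) = ti at *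
      generalize ((b / d : Rˣ) : R) = t at *
      generalize ((d / c : Rˣ) : R) = u at *
      linear_combination (u - t) * u * x * hE - T * u * Pj * ht +
        T * E * x * (d : R) * ((c⁻¹ : Rˣ) : R) * hac + T * E * x * (u - t) * hdc

theorem parisAux_eq_of_parisNorm_eq (hM : IsSmall M) {j' : (I → ℝ) → I} {n : ℕ}
    {v w : I → ℝ} (hv : Lev M n v) (hw : Lev M n w) {i k : I}
    (h : parisNorm M b c d x j i v = parisNorm M b c d x j' k w) :
    parisAux M b c d x j (depth M v) i v = parisAux M b c d x j' (depth M w) k w := by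
  rw [parisNorm, parisNorm, hv.depth_eq hM, hw.depth_eq hM] at h
  rw [hv.depth_eq hM, hw.depth_eq hM]
  exact (Units.mul_right_inj _).mp (add_right_cancel h)

theorem parisFamily_e (i : I) (α : posRoots M) :
    parisFamily M b c d x j i (e M R α) = parisAux M b c d x j (depth M α) i α := by
  rw [parisFamily, e, Finsupp.linearCombination_single, one_smul]

/-- The transport of the family by g solves the normalised recursion for the choice v ↦ g⁻¹(j(g(v)))
with the same initial values. By uniqueness it is Paris's family for that choice, hence the original
one by independence. -/
theorem parisFamily_invariant (hM : IsSmall M) (hj : IsChoice M j) (hind : ParisIndep M b c d x)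
    (i : I) (α : posRoots M) (g : aut M) :
    parisFamily M b c d x j i (e M R α) =
      parisFamily M b c d x j ((g : Equiv.Perm I) i) (e M R (autRoot M g α)) := by
  have hj1 := (isChoice_iff hM).mp hj
  have hj2 := hj1.permE g
  have hα := lev_depth hM α.2
  -- The first rewrite passes to the conjugate choice on both sides; once the left side is unfolded,
  -- the backward rewrite restores j on the right.
  rw [hind j _ hj ((isChoice_iff hM).mpr hj2), parisFamily_e, ← hind j _ hj
    ((isChoice_iff hM).mpr hj2), parisFamily_e]
  exact parisAux_eq_of_parisNorm_eq hM hα (hα.permE g)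
    (ParisSystem.unique hM hj2 (parisSystem_parisNorm hM hj2)
      ((parisSystem_parisNorm hM hj1).permE g) hα i)

theorem parisIndep_of_noTriangle (hM : IsSmall M) (hT : NoTriangle M) : ParisIndep M b c d x := by
  intro j j' hj hj'
  rw [isChoice_iff hM] at hj hj'
  funext i
  refine Finsupp.lhom_ext' fun α => LinearMap.ext_ring ?_
  change parisFamily M b c d x j i (e M R α) = parisFamily M b c d x j' i (e M R α)
  rw [parisFamily_e, parisFamily_e]
  exact parisAux_eq_of_parisNorm_eq hM (lev_depth hM α.2) (lev_depth hM α.2)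
    (ParisSystem.unique hM hj' ((parisSystem_parisNorm hM hj).change_choice hM hT hj hj')
      (parisSystem_parisNorm hM hj') (lev_depth hM α.2) i)

end Paris

end LK

/-! ### The main theorem. -/

theorem mainTheorem5 {I : Type*} [Fintype I] [DecidableEq I] (Γ : CoxeterMatrix I)
    (hΓ : LK.IsSmall Γ) {R : Type*} [CommRing R] (b c d : Rˣ) :
    (∀ f : I → Module.Dual R (LK.V Γ R), LK.IsLKFamily Γ b c d f →
      ((LK.IsIrreducible Γ ∧ LK.IsSpherical Γ) ∨
        LK.IsAffine Γ ∨
        (∃ (x : R) (j : (I → ℝ) → I), LK.IsChoice Γ j ∧ f = LK.parisFamily Γ b c d x j ∧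
          LK.ParisIndep Γ b c d x)) →
      ∀ (i : I) (α : LK.posRoots Γ) (g : LK.aut Γ),
        f i (LK.e Γ R α) = f ((g : Equiv.Perm I) i) (LK.e Γ R (LK.autRoot Γ g α))) ∧
    (LK.NoTriangle Γ → ∀ x : R, LK.ParisIndep Γ b c d x) := by
  refine ⟨fun f hf h i α g => ?_, fun hT x => LK.parisIndep_of_noTriangle hΓ hT⟩
  have he : ∀ i (α : LK.posRoots Γ), f i (LK.e Γ R α) = f i (LK.eVec Γ R α) := fun i α => by
    rw [LK.eVec, dif_pos α.2]
  rcases h with ⟨hI, hS⟩ | hA | ⟨x, j, hj, rfl, hind⟩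
  · rw [he, he]
    exact (hf.lkEq hΓ).invariant_of_spherical hΓ hI hS b.isUnit c.isUnit d.isUnit g
      (LK.lev_depth hΓ α.2) i
  · obtain ⟨hI, ⟨δ, hpos, hδ⟩, haut⟩ := hA.data
    rw [he, he]
    exact (hf.lkEq hΓ).invariant_of_null hΓ hI hpos hδ haut b.isUnit c.isUnit d.isUnit
      (LK.lev_depth hΓ α.2) i g
  · exact LK.parisFamily_invariant hΓ hj hind i α g
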